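/- Theorem. Let $\sigma_3=\mathrm{diag}(1,-1)$. For a smooth function $q:\mathbb R^3\to\mathbb C$ of $(x,y,t)$ put $r=q^*$ (complex conjugate), $\mathbf Q=\begin{pmatrix}0&r\\q&0\end{pmatrix}$ and, for $\lambda\in\mathbb C$, $$\mathbf U=\mathrm i(\lambda\sigma_3+\mathbf Q),\qquad \mathbf V=2\Big(\mathrm i\lambda^2\sigma_3+\mathrm i\lambda\mathbf Q-\tfrac{\mathrm i}{2}\sigma_3\mathbf Q^2+\tfrac12\sigma_3\mathbf Q_x\Big),$$ $$\mathbf W=-4\mathrm i\lambda^3\sigma_3-4\mathrm i\lambda^2\mathbf Q+2\lambda(\mathrm i\sigma_3\mathbf Q^2-\sigma_3\mathbf Q_x)+\mathrm i\mathbf Q_{xx}+2\mathrm i\mathbf Q^3+\mathbf Q_x\mathbf Q-\mathbf Q\mathbf Q_x .$$ The Lax pair of $q$ is the linear system $\Phi_x=\mathbf U\Phi$, $\Phi_y=\mathbf V\Phi$, $\Phi_t=\mathbf W\Phi$. The second and third AKNS flows (with $r=q^*$) are $$\mathrm i q_y=-q_{xx}-2q^2r,\quad \mathrm i r_y=r_{xx}+2qr^2;\qquad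 q_t=q_{xxx}+6q_xqr,\quad r_t=r_{xxx}+6qrr_x .$$ Let $q\in L^\infty(\mathbb R^3)\cap C^\infty(\mathbb R^3)$ solve the second and third AKNS flows with $r=q^*$. Let $\Phi(\lambda;x,y,t)$ be a $2\times2$ matrix function which is entire in $\lambda$ for every $(x,y,t)$ and which, for every $\lambda\in\mathbb C$, is differentiable in $(x,y,t)$ and solves the Lax pair of $q$. Let $N\ge 0$ and let $\lambda_1,\dots,\lambda_N\in\mathbb C$ be pairwise distinct with $\lambda_i^*\ne\lambda_j$ for all $i,j$ (in particular no $\lambda_i$ is real), and suppose that $\Phi(\lambda_i;0,0,0)$ is invertible for every $i$. Let $c_1,\dots,c_N:\mathbb R^3\to\mathbb C\setminus\{0\}$ be arbitrary functions and put $$\phi_i=[\phi_{i,1},\phi_{i,2}]^{\mathrm T}=c_i(x,y,t)\,\Phi(\lambda_i;x,y,t)\,\Phi^{-1}(\lambda_i;0,0,0)\,(1,-\mathrm i)^{\mathrm T},\qquad \mathbf Y_N=[\phi_1,\dots,\phi_N],$$ $$\mathbf M=\Big(\frac{\phi_i^\dagger\phi_j}{\lambda_i^*-\lambda_j}\Big)_{1\le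 i,j\le N},\qquad \mathbf D=\mathrm{diag}(\lambda-\lambda_1^*,\dots,\lambda-\lambda_N^*).$$ Then $\mathbf M$ is invertible at every $(x,y,t)$. With $$\mathbf T_N(\lambda;x,y,t)=\mathbb I+\mathbf Y_N\mathbf M^{-1}\mathbf D^{-1}\mathbf Y_N^\dagger,\qquad q^{[N]}=q+2\,\mathbf Y_{N,2}\mathbf M^{-1}\mathbf Y_{N,1}^\dagger,$$ where $\mathbf Y_{N,i}$ is the $i$-th row of $\mathbf Y_N$, the following hold. 1. $\mathbf T_N$ and $q^{[N]}$ are the result of $N$ successive elementary Darboux transformations: put $\mathbf T_0=\mathbb I$, $q^{[0]}=q$ and, for $k=1,\dots,N$, let $\mathbf T_k$ and $q^{[k]}$ be the recursively defined $$w_k=\mathbf T_{k-1}(\lambda_k)\phi_k,\qquad \mathbf T_k(\lambda)=\Big(\mathbb I-\frac{\lambda_k-\lambda_k^*}{\lambda-\lambda_k^*}\frac{w_kw_k^\dagger}{w_k^\dagger w_k}\Big)\mathbf T_{k-1}(\lambda),\qquad q^{[k]}=q^{[k-1]}-2(\lambda_k-\lambda_k^*)\frac{w_{k,2}w_{k,1}^*}{w_k^\dagger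 w_k};$$ then the $N$-th member of this recursion is given by the two formulas above, for all $\lambda\notin\{\lambda_1^*,\dots,\lambda_N^*\}$. 2. For every $\lambda\notin\{\lambda_1^*,\dots,\lambda_N^*\}$ the matrix $\mathbf T_N$ is differentiable in $(x,y,t)$ and transforms the Lax pair of $q$ into the Lax pair of $q^{[N]}$: with $\mathbf U^{[N]},\mathbf V^{[N]},\mathbf W^{[N]}$ built from $q^{[N]}$ and $r^{[N]}=(q^{[N]})^*$, $$(\mathbf T_N)_x+\mathbf T_N\mathbf U=\mathbf U^{[N]}\mathbf T_N,\quad (\mathbf T_N)_y+\mathbf T_N\mathbf V=\mathbf V^{[N]}\mathbf T_N,\quad (\mathbf T_N)_t+\mathbf T_N\mathbf W=\mathbf W^{[N]}\mathbf T_N .$$ In particular $\mathbf T_N\Phi$ solves the Lax pair of $q^{[N]}$. If moreover $\lambda\notin\{\lambda_1,\dots,\lambda_N\}$, then $\mathbf T_N(\lambda;x,y,t)$ is invertible. 3. $q^{[N]}\in C^\infty(\mathbb R^3)$ and $q^{[N]}$, $r^{[N]}=(q^{[N]})^*$ solve the second and third AKNS flows; consequently $u=q^{[N]}r^{[N]}$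 solves the KP equation $(4u_t-12uu_x-u_{xxx})_x+3u_{yy}=0$. -/

import Mathlib

open scoped Matrix ContDiff ComplexConjugate

namespace AKNS

noncomputable section

/-- The space of the independent variables `(x, y, t)`. -/
abbrev Space : Type := ℝ × ℝ × ℝ

/-- `2 × 2` complex matrices. -/
abbrev Mat2 : Type := Matrix (Fin 2) (Fin 2) ℂ

/-- Partial derivative in `x`. -/
def dx (f : Space → ℂ) (p : Space) : ℂ := fderiv ℝ f p (1, 0, 0)

/-- Partial derivative in `y`. -/
def dy (f : Space → ℂ) (p : Space) : ℂ := fderiv ℝ f p (0, 1, 0)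

/-- Partial derivative in `t`. -/
def dt (f : Space → ℂ) (p : Space) : ℂ := fderiv ℝ f p (0, 0, 1)

/-- A derivation applied to each entry of a matrix-valued function. -/
def entrywise (d : (Space → ℂ) → Space → ℂ) (A : Space → Mat2) (p : Space) : Mat2 :=
  Matrix.of fun i j => d (fun s => A s i j) p

/-- Differentiability in `(x, y, t)` of a matrix-valued function. -/
def DifferentiableMat (A : Space → Mat2) : Prop :=
  ∀ i j, Differentiable ℝ fun p => A p i j

/-- The second flow of the AKNS hierarchy. -/
def SecondFlow (q r : Space → ℂ) : Prop :=
  ∀ p, Complex.I * dy q p = -dx (dx q) p - 2 * q p ^ 2 * r p ∧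
    Complex.I * dy r p = dx (dx r) p + 2 * q p * r p ^ 2

/-- The third flow of the AKNS hierarchy. -/
def ThirdFlow (q r : Space → ℂ) : Prop :=
  ∀ p, dt q p = dx (dx (dx q)) p + 6 * dx q p * q p * r p ∧
    dt r p = dx (dx (dx r)) p + 6 * q p * r p * dx r p

/-- The Kadomtsev-Petviashvili equation `(4 u_t - 12 u u_x - u_xxx)_x + 3 u_yy = 0`. -/
def KP (u : Space → ℂ) : Prop :=
  ∀ p, dx (fun s => 4 * dt u s - 12 * u s * dx u s - dx (dx (dx u)) s) p
    + 3 * dy (dy u) p = 0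

/-- The complex conjugate `r = q^*` of a potential. -/
def conjPot (q : Space → ℂ) (p : Space) : ℂ := conj (q p)

/-- The third Pauli matrix. -/
def sigma3 : Mat2 := !![1, 0; 0, -1]

/-- The potential matrix `Q`, with `r = q^*`. -/
def potMat (q : Space → ℂ) (p : Space) : Mat2 := !![0, conjPot q p; q p, 0]

/-- The matrix `U(z; x, y, t)` of the Lax pair. -/
def laxU (q : Space → ℂ) (z : ℂ) (p : Space) : Mat2 :=
  Complex.I • (z • sigma3 + potMat q p)

/-- The matrix `V(z; x, y, t)` of the Lax pair. -/
def laxV (q : Space → ℂ) (z : ℂ) (p : Space) : Mat2 :=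
  (2 : ℂ) • ((Complex.I * z ^ 2) • sigma3 + (Complex.I * z) • potMat q p
    - (Complex.I / 2) • (sigma3 * potMat q p ^ 2)
    + (1 / 2 : ℂ) • (sigma3 * entrywise dx (potMat q) p))

/-- The matrix `W(z; x, y, t)` of the Lax pair. -/
def laxW (q : Space → ℂ) (z : ℂ) (p : Space) : Mat2 :=
  (-4 * Complex.I * z ^ 3) • sigma3 - (4 * Complex.I * z ^ 2) • potMat q p
    + (2 * z) • (Complex.I • (sigma3 * potMat q p ^ 2) - sigma3 * entrywise dx (potMat q) p)
    + Complex.I • entrywise dx (entrywise dx (potMat q)) p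
    + (2 * Complex.I) • potMat q p ^ 3
    + entrywise dx (potMat q) p * potMat q p - potMat q p * entrywise dx (potMat q) p

/-- `Ψ` is a matrix solution, at the spectral parameter `z`, of the linear system
`Ψ_x = U Ψ`, `Ψ_y = V Ψ`, `Ψ_t = W Ψ` with potential `q` and `r = q^*`. -/
structure IsLaxSolution (q : Space → ℂ) (z : ℂ) (Ψ : Space → Mat2) : Prop where
  differentiable : DifferentiableMat Ψ
  eq_x : ∀ p, entrywise dx Ψ p = laxU q z p * Ψ p
  eq_y : ∀ p, entrywise dy Ψ p = laxV q z p * Ψ p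
  eq_t : ∀ p, entrywise dt Ψ p = laxW q z p * Ψ p

/-- `T` is a gauge transformation, at the spectral parameter `z`, of the Lax pair with potential
`q` into the Lax pair of the same form with potential `q'`. -/
structure IsDarboux (q q' : Space → ℂ) (z : ℂ) (T : Space → Mat2) : Prop where
  differentiable : DifferentiableMat T
  eq_x : ∀ p, entrywise dx T p + T p * laxU q z p = laxU q' z p * T p
  eq_y : ∀ p, entrywise dy T p + T p * laxV q z p = laxV q' z p * T p
  eq_t : ∀ p, entrywise dt T p + T p * laxW q z p = laxW q' z p * T p

/-- The vector `c Φ(μ; x, y, t) Φ⁻¹(μ; 0, 0, 0) (1, -i)ᵀ`. -/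
def phi (Φ : ℂ → Space → Mat2) (μ : ℂ) (c : Space → ℂ) (p : Space) : Fin 2 → ℂ :=
  c p • ((Φ μ p * (Φ μ (0, 0, 0))⁻¹) *ᵥ ![1, -Complex.I])

/-! The following constructions are carried out at a fixed point `(x, y, t)`; `lam i` are the
spectral parameters and `v i` the values of the vectors `φ_i` at that point. -/

/-- The matrix `Y_N = [φ_1, …, φ_N]`. -/
def matY {N : ℕ} (v : Fin N → Fin 2 → ℂ) : Matrix (Fin 2) (Fin N) ℂ :=
  Matrix.of fun a i => v i a

/-- The matrix `M = (φ_i† φ_j / (λ_i^* - λ_j))`. -/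
def matM {N : ℕ} (lam : Fin N → ℂ) (v : Fin N → Fin 2 → ℂ) : Matrix (Fin N) (Fin N) ℂ :=
  Matrix.of fun i j => (star (v i) ⬝ᵥ v j) / (conj (lam i) - lam j)

/-- The matrix `D = diag(z - λ_1^*, …, z - λ_N^*)`. -/
def matD {N : ℕ} (lam : Fin N → ℂ) (z : ℂ) : Matrix (Fin N) (Fin N) ℂ :=
  Matrix.diagonal fun i => z - conj (lam i)

/-- The matrix `T_N = I + Y_N M⁻¹ D⁻¹ Y_N†`. -/
def darbouxT {N : ℕ} (lam : Fin N → ℂ) (v : Fin N → Fin 2 → ℂ) (z : ℂ) : Mat2 :=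
  1 + matY v * (matM lam v)⁻¹ * (matD lam z)⁻¹ * (matY v)ᴴ

/-- The value `q + 2 Y_{N,2} M⁻¹ Y_{N,1}†`, where `Y_{N,i}` is the `i`-th row of `Y_N` and `q₀` is
the value of `q`. -/
def darbouxPot {N : ℕ} (lam : Fin N → ℂ) (v : Fin N → Fin 2 → ℂ) (q₀ : ℂ) : ℂ :=
  q₀ + 2 * (matY v 1 ⬝ᵥ ((matM lam v)⁻¹ *ᵥ star (matY v 0)))

/-- The elementary Darboux matrix `I - (μ - μ^*)/(z - μ^*) w w† / (w† w)`. -/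
def elemT (μ : ℂ) (w : Fin 2 → ℂ) (z : ℂ) : Mat2 :=
  1 - ((μ - conj μ) / (z - conj μ)) • ((star w ⬝ᵥ w)⁻¹ • Matrix.vecMulVec w (star w))

/-- The elementary Bäcklund transformation `q - 2 (μ - μ^*) w_2 w_1^* / (w† w)`. -/
def elemPot (μ : ℂ) (w : Fin 2 → ℂ) (q₀ : ℂ) : ℂ :=
  q₀ - 2 * (μ - conj μ) * (w 1 * conj (w 0) / (star w ⬝ᵥ w))

/-- The `N`-fold iteration of the elementary Darboux transformation: in each step the next vector
is transformed by the matrix built so far, evaluated at the next spectral parameter. -/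
def iterT : (N : ℕ) → (Fin N → ℂ) → (Fin N → Fin 2 → ℂ) → ℂ → Mat2
  | 0, _, _, _ => 1
  | n + 1, lam, v, z =>
      elemT (lam (Fin.last n))
          (iterT n (fun i => lam i.castSucc) (fun i => v i.castSucc) (lam (Fin.last n))
            *ᵥ v (Fin.last n)) z
        * iterT n (fun i => lam i.castSucc) (fun i => v i.castSucc) z

/-- The potential obtained by the `N`-fold iteration of the elementary transformation. -/
def iterPot : (N : ℕ) → (Fin N → ℂ) → (Fin N → Fin 2 → ℂ) → ℂ → ℂ
  | 0, _, _, q₀ => q₀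
  | n + 1, lam, v, q₀ =>
      elemPot (lam (Fin.last n))
          (iterT n (fun i => lam i.castSucc) (fun i => v i.castSucc) (lam (Fin.last n))
            *ᵥ v (Fin.last n))
        (iterPot n (fun i => lam i.castSucc) (fun i => v i.castSucc) q₀)

end

end AKNS

/-!
The matrices `U`, `V`, `W` of the Lax pair are anti-Hermitian in the sense that
`U(z)† = -U(z^*)`, because `r = q^*`. Hence if `w` is a vector solution of the Lax pair at `μ`,
then `w†` solves the adjoint system at `μ^*`, and the orthogonal projector `P = w w† / (w† w)`
satisfies Riccati equations in `x`, `y` and `t` whose coefficients are polynomials in `P`, `q`, `r`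
and the `x`-derivatives of `q` and `r`. With these equations, and with `P² = P` and `tr P = 1`, all
statements about one elementary Darboux transformation become polynomial identities: the gauge
relations for `I - (μ - μ^*)/(z - μ^*) P`, and the flows for `q - 2 (μ - μ^*) P₂₁`. They are proved
over an arbitrary commutative ring with derivations (`IsDressing.second_flow`,
`IsDressing.third_flow`, `IsDressing.gauge_x`, `IsDressing.gauge_y`, `IsDressing.gauge_t`) and
applied to the algebra of smooth functions (`darboux_step`). The derivations used are
`-i ∂_x`, `-i ∂_y`, `-i ∂_t`; this choice removes the imaginary unit from every identity, so that
the only relation left is the one for the entries of `P`. The KP equation is one more identity of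
this kind (`kp_of_flows`).

The `N`-fold transformation follows by induction (`iterated_darboux`): gauge transformations of Lax
pairs compose and carry solutions to solutions, so the transformed `φ_k` is again a vector solution
for the current potential. It does not vanish, since the Darboux matrices satisfy
`T(z^*)† T(z) = I`, and since `det Φ` is constant by the tracelessness of the Lax matrices.

The closed formulas are linear algebra at a fixed point (`closed_form`). By partial fractions the
iterated matrix is `I + X D⁻¹ Y†` for some `X`, and it annihilates `φ_k` at `λ_k`, which says that
`X M = Y`. It follows that the kernel of `M` lies in that of `Y` and is stable under
`diag(λ_1, …, λ_N)`; a Vandermonde argument then shows that it is trivial, so `X = Y M⁻¹`.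
-/

namespace AKNS

/-! ### Elementary Darboux transformations over a ring with derivations -/

section Algebra

variable {k R : Type*} [CommRing k] [CommRing R] [Algebra k R]

/-- The matrix `-i U(z)` over a commutative ring. -/
def redU (q r z : R) : Matrix (Fin 2) (Fin 2) R := !![z, r; q, -z]

/-- The matrix `-i V(z)` over a commutative ring; `q₁`, `r₁` stand for `-i q_x`, `-i r_x`. -/
def redV (q r q₁ r₁ z : R) : Matrix (Fin 2) (Fin 2) R :=
  !![2 * z ^ 2 - q * r, 2 * z * r + r₁; 2 * z * q - q₁, -(2 * z ^ 2 - q * r)]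

/-- The matrix `-i W(z)` over a commutative ring; `qⱼ`, `rⱼ` stand for `(-i ∂_x)ʲ q`,
`(-i ∂_x)ʲ r`. -/
def redW (q r q₁ r₁ q₂ r₂ z : R) : Matrix (Fin 2) (Fin 2) R :=
  !![-4 * z ^ 3 + 2 * z * q * r + r₁ * q - r * q₁,
      -4 * z ^ 2 * r - 2 * z * r₁ - r₂ + 2 * q * r ^ 2;
    -4 * z ^ 2 * q + 2 * z * q₁ - q₂ + 2 * q ^ 2 * r,
      -(-4 * z ^ 3 + 2 * z * q * r + r₁ * q - r * q₁)]

/-- The right-hand side of the Riccati equation satisfied by the rank one projector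
`P = w v / (v w)` when `w' = A w` and `v' = -v B`. -/
def riccati (A B P : Matrix (Fin 2) (Fin 2) R) : Matrix (Fin 2) (Fin 2) R :=
  A * P - P * B - ((A - B) * P).trace • P

theorem riccati_apply (A B P : Matrix (Fin 2) (Fin 2) R) (i j : Fin 2) :
    riccati A B P i j = A i 0 * P 0 j + A i 1 * P 1 j - (P i 0 * B 0 j + P i 1 * B 1 j)
      - ((A 0 0 - B 0 0) * P 0 0 + (A 0 1 - B 0 1) * P 1 0
        + ((A 1 0 - B 1 0) * P 0 1 + (A 1 1 - B 1 1) * P 1 1)) * P i j := by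
  simp only [riccati, Matrix.sub_apply, Matrix.mul_apply, Matrix.trace_fin_two, Matrix.smul_apply,
    Fin.sum_univ_two, smul_eq_mul]

/-- The Riccati equation of the projector; `ν` is the reciprocal of `v w`. -/
theorem derivation_projector (D : Derivation k R R) (A B : Matrix (Fin 2) (Fin 2) R)
    (w v : Fin 2 → R) (ν : R) (hν : ν * (w 0 * v 0 + w 1 * v 1) = 1)
    (hw : ∀ i, D (w i) = A i 0 * w 0 + A i 1 * w 1)
    (hv : ∀ j, D (v j) = -(v 0 * B 0 j + v 1 * B 1 j)) (i j : Fin 2) :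
    D (w i * v j * ν) = riccati A B (Matrix.of fun i j => w i * v j * ν) i j := by
  have hn : D ν * (w 0 * v 0 + w 1 * v 1) + ν * D (w 0 * v 0 + w 1 * v 1) = 0 := by
    have h := congrArg D hν
    simp only [Derivation.leibniz, smul_eq_mul, Derivation.map_one_eq_zero] at h ⊢
    linear_combination h
  have hDν : D ν = -ν ^ 2 * D (w 0 * v 0 + w 1 * v 1) := by
    linear_combination ν * hn - D ν * hν
  simp only [Derivation.leibniz, smul_eq_mul, hDν, map_add, hw, hv, riccati_apply,
    Matrix.of_apply]
  ring

/-- `P` is a rank one projector depending on the independent variables as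
`w v / (v w)`, where `w` solves the Lax system of `(q, r)` at the spectral parameter `μ` and `v`
the adjoint system at the spectral parameter `m`. The derivations `X`, `Y`, `T` stand for
`-i ∂_x`, `-i ∂_y`, `-i ∂_t`, so that the imaginary unit does not occur.
The trace and determinant conditions make `P` idempotent of rank one. In all identities below the
lower right entry is eliminated by `trace`; what remains is a multiple of `det`, with a cofactor
that is the polynomial quotient by this relation. -/
structure IsDressing (X Y T : Derivation k R R) (q r μ m : R)
    (P : Matrix (Fin 2) (Fin 2) R) : Prop where
  trace : P 1 1 = 1 - P 0 0
  det : P 0 1 * P 1 0 = P 0 0 - P 0 0 ^ 2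
  flow_x : ∀ i j, X (P i j) = riccati (redU q r μ) (redU q r m) P i j
  flow_y : ∀ i j, Y (P i j) =
    riccati (redV q r (X q) (X r) μ) (redV q r (X q) (X r) m) P i j
  flow_t : ∀ i j, T (P i j) =
    riccati (redW q r (X q) (X r) (X (X q)) (X (X r)) μ)
      (redW q r (X q) (X r) (X (X q)) (X (X r)) m) P i j

theorem isDressing_projector (X Y T : Derivation k R R) (q r μ m : R)
    (w v : Fin 2 → R) (ν : R) (hν : ν * (w 0 * v 0 + w 1 * v 1) = 1)
    (hXw : ∀ i, X (w i) = redU q r μ i 0 * w 0 + redU q r μ i 1 * w 1)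
    (hXv : ∀ j, X (v j) = -(v 0 * redU q r m 0 j + v 1 * redU q r m 1 j))
    (hYw : ∀ i, Y (w i) = redV q r (X q) (X r) μ i 0 * w 0 + redV q r (X q) (X r) μ i 1 * w 1)
    (hYv : ∀ j, Y (v j) =
      -(v 0 * redV q r (X q) (X r) m 0 j + v 1 * redV q r (X q) (X r) m 1 j))
    (hTw : ∀ i, T (w i) = redW q r (X q) (X r) (X (X q)) (X (X r)) μ i 0 * w 0
      + redW q r (X q) (X r) (X (X q)) (X (X r)) μ i 1 * w 1)
    (hTv : ∀ j, T (v j) = -(v 0 * redW q r (X q) (X r) (X (X q)) (X (X r)) m 0 j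
      + v 1 * redW q r (X q) (X r) (X (X q)) (X (X r)) m 1 j)) :
    IsDressing X Y T q r μ m (Matrix.of fun i j => w i * v j * ν) where
  trace := by simp only [Matrix.of_apply]; linear_combination hν
  det := by
    simp only [Matrix.of_apply]
    linear_combination w 0 * v 0 * ν * hν
  flow_x := derivation_projector X _ _ w v ν hν hXw hXv
  flow_y := derivation_projector Y _ _ w v ν hν hYw hYv
  flow_t := derivation_projector T _ _ w v ν hν hTw hTv

namespace IsDressing

variable {X Y T : Derivation k R R} {q r μ m : R} {P : Matrix (Fin 2) (Fin 2) R}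

theorem X_diag (h : IsDressing X Y T q r μ m P) :
    X (P 0 0) = 2 * (μ - m) * (P 0 0 - P 0 0 ^ 2) - q * P 0 1 + r * P 1 0 := by
  rw [h.flow_x]
  simp [riccati_apply, redU, h.trace]
  ring

theorem X_upper (h : IsDressing X Y T q r μ m P) :
    X (P 0 1) = -2 * (μ - m) * P 0 0 * P 0 1 + 2 * μ * P 0 1 - 2 * r * P 0 0 + r := by
  rw [h.flow_x]
  simp [riccati_apply, redU, h.trace]
  ring

theorem X_lower (h : IsDressing X Y T q r μ m P) :
    X (P 1 0) = -2 * (μ - m) * P 0 0 * P 1 0 - 2 * m * P 1 0 + 2 * q * P 0 0 - q := by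
  rw [h.flow_x]
  simp [riccati_apply, redU, h.trace]
  ring

/-- The Darboux matrix `(z - m) I - (μ - m) P`, freed of its denominator. -/
def gauge (μ m : R) (P : Matrix (Fin 2) (Fin 2) R) (z : R) : Matrix (Fin 2) (Fin 2) R :=
  !![z - m - (μ - m) * P 0 0, -(μ - m) * P 0 1; -(μ - m) * P 1 0, z - m - (μ - m) * P 1 1]

/-- In the dressed pair the potential is `q - 2 (μ - m) P₂₁` and its partner, which is the conjugate
one when `m = μ^*` and `P` is Hermitian, is `r + 2 (μ - m) P₁₂`. -/
theorem X_pot (h : IsDressing X Y T q r μ m P) (hμ : X μ = 0) (hm : X m = 0) :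
    X (q - 2 * (μ - m) * P 1 0) = X q + 4 * (μ - m) ^ 2 * P 0 0 * P 1 0
      + 4 * (μ - m) * m * P 1 0 - 4 * (μ - m) * q * P 0 0 + 2 * (μ - m) * q := by
  have h2 : X 2 = 0 := X.map_natCast 2
  simp only [map_sub, Derivation.leibniz, smul_eq_mul, hμ, hm, h2, h.X_lower]
  ring

theorem X_conj_pot (h : IsDressing X Y T q r μ m P) (hμ : X μ = 0) (hm : X m = 0) :
    X (r + 2 * (μ - m) * P 0 1) = X r - 4 * (μ - m) ^ 2 * P 0 0 * P 0 1 + 4 * (μ - m) ^ 2 * P 0 1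
      + 4 * (μ - m) * m * P 0 1 - 4 * (μ - m) * r * P 0 0 + 2 * (μ - m) * r := by
  have h2 : X 2 = 0 := X.map_natCast 2
  simp only [map_add, map_sub, Derivation.leibniz, smul_eq_mul, hμ, hm, h2, h.X_upper]
  ring

theorem XX_pot (h : IsDressing X Y T q r μ m P) (hμ : X μ = 0) (hm : X m = 0) :
    X (X (q - 2 * (μ - m) * P 1 0)) = X (X q) - 16 * (μ - m) ^ 3 * P 0 0 ^ 2 * P 1 0
      + 8 * (μ - m) ^ 3 * P 0 0 * P 1 0 - 16 * (μ - m) ^ 2 * m * P 0 0 * P 1 0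
      + 20 * (μ - m) ^ 2 * q * P 0 0 ^ 2 - 16 * (μ - m) ^ 2 * q * P 0 0
      + 4 * (μ - m) ^ 2 * r * P 1 0 ^ 2 - 8 * (μ - m) * m ^ 2 * P 1 0
      + 8 * (μ - m) * m * q * P 0 0 - 4 * (μ - m) * m * q + 4 * (μ - m) * q ^ 2 * P 0 1
      - 4 * (μ - m) * q * r * P 1 0 - 4 * (μ - m) * X q * P 0 0 + 2 * (μ - m) * X q := by
  have h2 : X 2 = 0 := X.map_natCast 2
  have h4 : X 4 = 0 := X.map_natCast 4
  rw [h.X_pot hμ hm]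
  simp only [map_add, map_sub, Derivation.leibniz, Derivation.leibniz_pow, smul_eq_mul, hμ, hm,
    h2, h4, h.X_lower, h.X_diag, nsmul_eq_mul]
  linear_combination (-4 * (μ - m) ^ 2 * q) * h.det

theorem XX_conj_pot (h : IsDressing X Y T q r μ m P) (hμ : X μ = 0) (hm : X m = 0) :
    X (X (r + 2 * (μ - m) * P 0 1)) = X (X r) + 16 * (μ - m) ^ 3 * P 0 0 ^ 2 * P 0 1
      - 24 * (μ - m) ^ 3 * P 0 0 * P 0 1 + 8 * (μ - m) ^ 3 * P 0 1
      - 16 * (μ - m) ^ 2 * m * P 0 0 * P 0 1 + 16 * (μ - m) ^ 2 * m * P 0 1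
      + 4 * (μ - m) ^ 2 * q * P 0 1 ^ 2 + 20 * (μ - m) ^ 2 * r * P 0 0 ^ 2
      - 24 * (μ - m) ^ 2 * r * P 0 0 + 4 * (μ - m) ^ 2 * r + 8 * (μ - m) * m ^ 2 * P 0 1
      - 8 * (μ - m) * m * r * P 0 0 + 4 * (μ - m) * m * r + 4 * (μ - m) * q * r * P 0 1
      - 4 * (μ - m) * r ^ 2 * P 1 0 - 4 * (μ - m) * X r * P 0 0 + 2 * (μ - m) * X r := by
  have h2 : X 2 = 0 := X.map_natCast 2
  have h4 : X 4 = 0 := X.map_natCast 4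
  rw [h.X_conj_pot hμ hm]
  simp only [map_add, map_sub, Derivation.leibniz, Derivation.leibniz_pow, smul_eq_mul, hμ, hm,
    h2, h4, h.X_upper, h.X_diag, nsmul_eq_mul]
  linear_combination (-4 * (μ - m) ^ 2 * r) * h.det

/-- The dressed potential solves the second flow. -/
theorem second_flow (h : IsDressing X Y T q r μ m P) (hXμ : X μ = 0) (hXm : X m = 0)
    (hYμ : Y μ = 0) (hYm : Y m = 0) (hY : Y q = -X (X q) + 2 * q ^ 2 * r) :
    Y (q - 2 * (μ - m) * P 1 0) = -X (X (q - 2 * (μ - m) * P 1 0))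
      + 2 * (q - 2 * (μ - m) * P 1 0) ^ 2 * (r + 2 * (μ - m) * P 0 1) := by
  have h2 : Y 2 = 0 := Y.map_natCast 2
  rw [h.XX_pot hXμ hXm]
  simp only [map_sub, Derivation.leibniz, smul_eq_mul, hYμ, hYm, h2, hY, h.flow_y]
  simp [riccati_apply, redV, h.trace]
  linear_combination (-16 * (μ - m) ^ 3 * P 1 0 + 20 * (μ - m) ^ 2 * q) * h.det

/-- The dressed potential solves the third flow. -/
theorem third_flow (h : IsDressing X Y T q r μ m P) (hXμ : X μ = 0) (hXm : X m = 0)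
    (hTμ : T μ = 0) (hTm : T m = 0) (hT : T q = -X (X (X q)) + 6 * q * r * X q) :
    T (q - 2 * (μ - m) * P 1 0) = -X (X (X (q - 2 * (μ - m) * P 1 0)))
      + 6 * (q - 2 * (μ - m) * P 1 0) * (r + 2 * (μ - m) * P 0 1)
        * X (q - 2 * (μ - m) * P 1 0) := by
  have h2 : T 2 = 0 := T.map_natCast 2
  have h2' : X 2 = 0 := X.map_natCast 2
  have h4 : X 4 = 0 := X.map_natCast 4
  have h8 : X 8 = 0 := X.map_natCast 8
  have h16 : X 16 = 0 := X.map_natCast 16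
  have h20 : X 20 = 0 := X.map_natCast 20
  rw [h.XX_pot hXμ hXm, h.X_pot hXμ hXm]
  simp only [map_add, map_sub, Derivation.leibniz, Derivation.leibniz_pow, smul_eq_mul, hXμ, hXm,
    hTμ, hTm, h2, h2', h4, h8, h16, h20, h.X_upper, h.X_lower, h.X_diag, nsmul_eq_mul, hT,
    h.flow_t]
  simp [riccati_apply, redW, h.trace]
  linear_combination (96 * (μ - m) ^ 4 * P 0 0 * P 1 0 + 96 * (μ - m) ^ 3 * m * P 1 0
    - 112 * (μ - m) ^ 3 * q * P 0 0 + 32 * (μ - m) ^ 3 * q - 48 * (μ - m) ^ 2 * m * q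
    + 28 * (μ - m) ^ 2 * X q) * h.det

/-- The relation `G' + G U(z) = U'(z) G` for the gauge matrix `G`, written with
`G' = -(μ - m) P'`; `z` is a constant. -/
theorem gauge_x (h : IsDressing X Y T q r μ m P) (z : R)
    (i j : Fin 2) :
    -(μ - m) * X (P i j) + (gauge μ m P z * redU q r z
      - redU (q - 2 * (μ - m) * P 1 0) (r + 2 * (μ - m) * P 0 1) z
        * gauge μ m P z) i j = 0 := by
  rw [h.flow_x]
  simp only [Matrix.sub_apply, Matrix.mul_apply, Fin.sum_univ_two, riccati_apply, redU, gauge,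
    h.trace]
  fin_cases i <;> fin_cases j <;>
    simp only [Fin.zero_eta, Fin.mk_one, Fin.isValue, Matrix.of_apply, Matrix.cons_val_zero,
      Matrix.cons_val_one, Matrix.cons_val', Matrix.cons_val_fin_one, h.trace]
  · linear_combination (2 * (μ - m) ^ 2) * h.det
  · ring
  · ring
  · linear_combination (-2 * (μ - m) ^ 2) * h.det

theorem gauge_y (h : IsDressing X Y T q r μ m P) (hμ : X μ = 0) (hm : X m = 0) (z : R)
    (i j : Fin 2) :
    -(μ - m) * Y (P i j) + (gauge μ m P z * redV q r (X q) (X r) z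
      - redV (q - 2 * (μ - m) * P 1 0) (r + 2 * (μ - m) * P 0 1)
        (X (q - 2 * (μ - m) * P 1 0)) (X (r + 2 * (μ - m) * P 0 1)) z
        * gauge μ m P z) i j = 0 := by
  rw [h.flow_y, h.X_pot hμ hm, h.X_conj_pot hμ hm]
  simp only [Matrix.sub_apply, Matrix.mul_apply, Fin.sum_univ_two, riccati_apply, redV, gauge,
    h.trace]
  fin_cases i <;> fin_cases j <;>
    simp only [Fin.zero_eta, Fin.mk_one, Fin.isValue, Matrix.of_apply, Matrix.cons_val_zero,
      Matrix.cons_val_one, Matrix.cons_val', Matrix.cons_val_fin_one, h.trace]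
  · linear_combination (4 * (μ - m) ^ 3 + 8 * (μ - m) ^ 2 * m) * h.det
  · linear_combination (4 * (μ - m) ^ 3 * P 0 1 + 4 * (μ - m) ^ 2 * r) * h.det
  · linear_combination (-4 * (μ - m) ^ 3 * P 1 0 + 4 * (μ - m) ^ 2 * q) * h.det
  · linear_combination (-4 * (μ - m) ^ 3 - 8 * (μ - m) ^ 2 * m) * h.det

theorem gauge_t (h : IsDressing X Y T q r μ m P) (hμ : X μ = 0) (hm : X m = 0) (z : R)
    (i j : Fin 2) :
    -(μ - m) * T (P i j) + (gauge μ m P z * redW q r (X q) (X r) (X (X q)) (X (X r)) z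
      - redW (q - 2 * (μ - m) * P 1 0) (r + 2 * (μ - m) * P 0 1)
        (X (q - 2 * (μ - m) * P 1 0)) (X (r + 2 * (μ - m) * P 0 1))
        (X (X (q - 2 * (μ - m) * P 1 0))) (X (X (r + 2 * (μ - m) * P 0 1))) z
        * gauge μ m P z) i j = 0 := by
  rw [h.flow_t, h.XX_pot hμ hm, h.XX_conj_pot hμ hm, h.X_pot hμ hm, h.X_conj_pot hμ hm]
  simp only [Matrix.sub_apply, Matrix.mul_apply, Fin.sum_univ_two, riccati_apply, redW, gauge,
    h.trace]
  fin_cases i <;> fin_cases j <;>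
    simp only [Fin.zero_eta, Fin.mk_one, Fin.isValue, Matrix.of_apply, Matrix.cons_val_zero,
      Matrix.cons_val_one, Matrix.cons_val', Matrix.cons_val_fin_one, h.trace]
  · linear_combination (-16 * (μ - m) ^ 4 * P 0 1 * P 1 0 - 8 * (μ - m) ^ 4 - 24 * (μ - m) ^
    3 * m + 4 * (μ - m) ^ 3 * q * P 0 1 - 16 * (μ - m) ^ 3 * r * P 1 0 - 24 * (μ - m) ^ 2 *
    m ^ 2 + 4 * (μ - m) ^ 2 * q * r) * h.det
  · linear_combination (16 * (μ - m) ^ 4 * P 0 0 * P 0 1 - 24 * (μ - m) ^ 4 * P 0 1 - 32 *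
    (μ - m) ^ 3 * m * P 0 1 + 8 * (μ - m) ^ 3 * z * P 0 1 + 20 * (μ - m) ^ 3 * r * P 0 0 -
    24 * (μ - m) ^ 3 * r - 28 * (μ - m) ^ 2 * m * r + 12 * (μ - m) ^ 2 * z * r - 4 * (μ - m)
    ^ 2 * X r) * h.det
  · linear_combination (16 * (μ - m) ^ 4 * P 0 0 * P 1 0 + 8 * (μ - m) ^ 4 * P 1 0 + 32 * (μ
    - m) ^ 3 * m * P 1 0 - 8 * (μ - m) ^ 3 * z * P 1 0 - 20 * (μ - m) ^ 3 * q * P 0 0 - 4 *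
    (μ - m) ^ 3 * q - 28 * (μ - m) ^ 2 * m * q + 12 * (μ - m) ^ 2 * z * q + 4 * (μ - m) ^ 2
    * X q) * h.det
  · linear_combination (16 * (μ - m) ^ 4 * P 0 1 * P 1 0 + 8 * (μ - m) ^ 4 + 24 * (μ - m) ^
    3 * m - 16 * (μ - m) ^ 3 * q * P 0 1 + 4 * (μ - m) ^ 3 * r * P 1 0 + 24 * (μ - m) ^ 2 *
    m ^ 2 - 4 * (μ - m) ^ 2 * q * r) * h.det

end IsDressing

/-- The second and third flows imply the KP equation, over a ring with derivations. -/
theorem kp_of_flows (X Y T : Derivation k R R) (hXY : ∀ f, Y (X f) = X (Y f)) (q r : R)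
    (hYq : Y q = -X (X q) + 2 * q ^ 2 * r) (hYr : Y r = X (X r) - 2 * q * r ^ 2)
    (hTq : T q = -X (X (X q)) + 6 * q * r * X q) (hTr : T r = -X (X (X r)) + 6 * q * r * X r) :
    X (4 * T (q * r) - 12 * (q * r) * X (q * r) + X (X (X (q * r)))) + 3 * Y (Y (q * r)) = 0 := by
  have h2 : X 2 = 0 := X.map_natCast 2
  have h4 : X 4 = 0 := X.map_natCast 4
  have h6 : X 6 = 0 := X.map_natCast 6
  have h12 : X 12 = 0 := X.map_natCast 12
  have h2' : Y 2 = 0 := Y.map_natCast 2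
  simp only [map_add, map_sub, map_neg, Derivation.leibniz, Derivation.leibniz_pow, smul_eq_mul,
    nsmul_eq_mul, hYq, hYr, hTq, hTr, hXY, h2, h4, h6, h12, h2', Derivation.map_natCast, map_zero]
  push_cast
  ring

end Algebra

/-! ### The algebra of smooth functions -/

section SmoothFunctions

/-- The `ℂ`-algebra of smooth functions of `(x, y, t)`. -/
def smoothAlg : Subalgebra ℂ (Space → ℂ) where
  carrier := {f | ContDiff ℝ ∞ f}
  mul_mem' {f g} (hf : ContDiff ℝ ∞ f) (hg : ContDiff ℝ ∞ g) := (hf.mul hg : ContDiff ℝ ∞ _)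
  add_mem' {f g} (hf : ContDiff ℝ ∞ f) (hg : ContDiff ℝ ∞ g) := (hf.add hg : ContDiff ℝ ∞ _)
  algebraMap_mem' c := (contDiff_const : ContDiff ℝ ∞ fun _ : Space => c)

theorem contDiff_coe (f : smoothAlg) : ContDiff ℝ ∞ (f : Space → ℂ) := f.2

theorem differentiable_coe (f : smoothAlg) : Differentiable ℝ (f : Space → ℂ) :=
  (contDiff_coe f).differentiable (by simp)

theorem contDiff_directional {f : Space → ℂ} (hf : ContDiff ℝ ∞ f) (e : Space) :
    ContDiff ℝ ∞ fun p => fderiv ℝ f p e :=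
  (hf.fderiv_right (m := ∞) (by simp)).clm_apply contDiff_const

/-- The directional derivative along `e`, as a derivation of the algebra of smooth functions. -/
noncomputable def partialDer (e : Space) : Derivation ℂ smoothAlg smoothAlg :=
  Derivation.mk'
    { toFun := fun f => ⟨fun p => fderiv ℝ (f : Space → ℂ) p e, contDiff_directional f.2 e⟩
      map_add' := fun f g => by
        ext p
        change fderiv ℝ ((f : Space → ℂ) + (g : Space → ℂ)) p e = _
        rw [fderiv_add (differentiable_coe f p) (differentiable_coe g p)]
        rfl
      map_smul' := fun c f => by
        ext p
        change fderiv ℝ (c • (f : Space → ℂ)) p e = _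
        rw [fderiv_const_smul (differentiable_coe f p)]
        rfl }
    fun f g => by
      ext p
      change fderiv ℝ ((f : Space → ℂ) * (g : Space → ℂ)) p e = _
      rw [fderiv_mul (differentiable_coe f p) (differentiable_coe g p)]
      rfl

/-- The derivation `-i ∂_e`. -/
noncomputable def redDer (e : Space) : Derivation ℂ smoothAlg smoothAlg :=
  (-Complex.I) • partialDer e

/-- Evaluation at a point. -/
def evalAt (p : Space) : smoothAlg →ₐ[ℂ] ℂ := (Pi.evalAlgHom ℂ (fun _ => ℂ) p).comp smoothAlg.val

theorem evalAt_apply (p : Space) (f : smoothAlg) : evalAt p f = (f : Space → ℂ) p := rfl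

theorem smoothAlg_ext {f g : smoothAlg} (h : ∀ p, evalAt p f = evalAt p g) : f = g :=
  Subtype.ext (funext h)

theorem evalAt_redDer (e p : Space) (f : smoothAlg) :
    evalAt p (redDer e f) = -Complex.I * fderiv ℝ (f : Space → ℂ) p e := rfl

theorem evalAt_const (p : Space) (c : ℂ) : evalAt p (algebraMap ℂ smoothAlg c) = c := rfl

theorem partialDer_comm (e e' : Space) (f : smoothAlg) :
    partialDer e (partialDer e' f) = partialDer e' (partialDer e f) := by
  ext p
  change fderiv ℝ (fun s => fderiv ℝ (f : Space → ℂ) s e') p e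
    = fderiv ℝ (fun s => fderiv ℝ (f : Space → ℂ) s e) p e'
  have hd : DifferentiableAt ℝ (fderiv ℝ (f : Space → ℂ)) p :=
    ((contDiff_coe f).fderiv_right (m := ∞) (by simp)).differentiable (by simp) p
  rw [fderiv_clm_apply hd (differentiableAt_const _),
    fderiv_clm_apply hd (differentiableAt_const _)]
  have hs := (contDiff_infty.1 (contDiff_coe f) 2).contDiffAt (x := p)
    |>.isSymmSndFDerivAt (by simp)
  simpa using hs e e'

theorem redDer_comm (e e' : Space) (f : smoothAlg) :
    redDer e (redDer e' f) = redDer e' (redDer e f) := by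
  simp only [redDer, Derivation.smul_apply, Derivation.map_smul, partialDer_comm e e']

/-- Complex conjugation of smooth functions. -/
def conjS : smoothAlg →+* smoothAlg where
  toFun f := ⟨fun p => conj ((f : Space → ℂ) p), Complex.conjCLE.contDiff.comp (contDiff_coe f)⟩
  map_one' := smoothAlg_ext fun _ => map_one conj
  map_mul' _ _ := smoothAlg_ext fun _ => map_mul conj _ _
  map_zero' := smoothAlg_ext fun _ => map_zero conj
  map_add' _ _ := smoothAlg_ext fun _ => map_add conj _ _

theorem evalAt_conjS (p : Space) (f : smoothAlg) : evalAt p (conjS f) = conj (evalAt p f) := rfl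

theorem conjS_conjS (f : smoothAlg) : conjS (conjS f) = f :=
  smoothAlg_ext fun _ => Complex.conj_conj _

theorem conjS_algebraMap (c : ℂ) :
    conjS (algebraMap ℂ smoothAlg c) = algebraMap ℂ smoothAlg (conj c) := rfl

theorem fderiv_conj {f : Space → ℂ} (hf : Differentiable ℝ f) (p e : Space) :
    fderiv ℝ (fun s => conj (f s)) p e = conj (fderiv ℝ f p e) := by
  have := (Complex.conjCLE.hasFDerivAt (x := f p)).comp p (hf p).hasFDerivAt
  rw [HasFDerivAt.fderiv (f := fun s => conj (f s)) this]
  rfl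

/-- Conjugation anticommutes with `-i ∂_e`, because of the factor `i`. -/
theorem redDer_conjS (e : Space) (f : smoothAlg) : redDer e (conjS f) = -conjS (redDer e f) := by
  refine smoothAlg_ext fun p => ?_
  rw [map_neg, evalAt_conjS, evalAt_redDer, evalAt_redDer]
  change -Complex.I * fderiv ℝ (fun s => conj ((f : Space → ℂ) s)) p e = _
  rw [fderiv_conj (differentiable_coe f)]
  simp

/-- A function with partial derivatives of class `C^n` is of class `C^(n+1)`. -/
theorem contDiff_succ_of_partials {f : Space → ℂ} {n : ℕ} (hf : Differentiable ℝ f)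
    (hx : ContDiff ℝ n (dx f)) (hy : ContDiff ℝ n (dy f)) (ht : ContDiff ℝ n (dt f)) :
    ContDiff ℝ (n + 1) f := by
  rw [contDiff_succ_iff_fderiv_apply]
  refine ⟨hf, by simp, fun v => ?_⟩
  have hv : v = v.1 • ((1, 0, 0) : Space) + v.2.1 • ((0, 1, 0) : Space)
      + v.2.2 • ((0, 0, 1) : Space) := by
    ext <;> simp
  have : (fun p => fderiv ℝ f p v) = fun p => v.1 • dx f p + v.2.1 • dy f p + v.2.2 • dt f p := by
    funext p
    conv_lhs => rw [hv]
    simp only [map_add, map_smul, dx, dy, dt]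
  rw [this]
  exact ((hx.const_smul _).add (hy.const_smul _)).add (ht.const_smul _)

end SmoothFunctions

/-! ### The Lax pair and its gauge transformations -/

section LaxSystem

theorem contDiff_dx {f : Space → ℂ} (hf : ContDiff ℝ ∞ f) : ContDiff ℝ ∞ (dx f) :=
  contDiff_directional hf _

theorem contDiff_conjPot {q : Space → ℂ} (hq : ContDiff ℝ ∞ q) : ContDiff ℝ ∞ (conjPot q) :=
  Complex.conjCLE.contDiff.comp hq

theorem entrywise_dx_potMat (q : Space → ℂ) (p : Space) :
    entrywise dx (potMat q) p = !![0, dx (conjPot q) p; dx q p, 0] := by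
  ext i j
  fin_cases i <;> fin_cases j <;> simp [entrywise, potMat, dx]

theorem entrywise_dx_dx_potMat (q : Space → ℂ) (p : Space) :
    entrywise dx (entrywise dx (potMat q)) p
      = !![0, dx (dx (conjPot q)) p; dx (dx q) p, 0] := by
  rw [funext (entrywise_dx_potMat q)]
  ext i j
  fin_cases i <;> fin_cases j <;> simp [entrywise] <;> simp [dx]

theorem laxU_eq (q : Space → ℂ) (z : ℂ) (p : Space) :
    laxU q z p = Complex.I • redU (q p) (conjPot q p) z := by
  ext i j
  fin_cases i <;> fin_cases j <;> simp [laxU, redU, sigma3, potMat]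

theorem laxV_eq (q : Space → ℂ) (z : ℂ) (p : Space) :
    laxV q z p = Complex.I • redV (q p) (conjPot q p) (-Complex.I * dx q p)
      (-Complex.I * dx (conjPot q) p) z := by
  rw [laxV, entrywise_dx_potMat]
  ext i j
  fin_cases i <;> fin_cases j <;>
    simp [redV, sigma3, potMat, pow_two]
  · ring
  · linear_combination dx (conjPot q) p * Complex.I_mul_I
  · linear_combination (-dx q p) * Complex.I_mul_I
  · ring

theorem laxW_eq (q : Space → ℂ) (z : ℂ) (p : Space) :
    laxW q z p = Complex.I • redW (q p) (conjPot q p) (-Complex.I * dx q p)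
      (-Complex.I * dx (conjPot q) p) (-dx (dx q) p) (-dx (dx (conjPot q)) p) z := by
  rw [laxW, entrywise_dx_dx_potMat, entrywise_dx_potMat]
  ext i j
  fin_cases i <;> fin_cases j <;>
    simp [redW, sigma3, potMat, pow_succ]
  · linear_combination
      (dx (conjPot q) p * q p - conjPot q p * dx q p) * Complex.I_mul_I
  · linear_combination (-2 * z * dx (conjPot q) p) * Complex.I_mul_I
  · linear_combination (2 * z * dx q p) * Complex.I_mul_I
  · linear_combination
      (conjPot q p * dx q p - dx (conjPot q) p * q p) * Complex.I_mul_I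

/-- Differentiable functions whose three partial derivatives are linear combinations of the
functions themselves, with smooth coefficients, are smooth: each order of differentiability yields
the next one. -/
theorem contDiff_of_linear_system {ι : Type*} [Fintype ι] (f : ι → Space → ℂ)
    (hf : ∀ i, Differentiable ℝ (f i)) (A B C : ι → ι → Space → ℂ)
    (hA : ∀ i j, ContDiff ℝ ∞ (A i j)) (hB : ∀ i j, ContDiff ℝ ∞ (B i j))
    (hC : ∀ i j, ContDiff ℝ ∞ (C i j))
    (hx : ∀ i p, dx (f i) p = ∑ j, A i j p * f j p)
    (hy : ∀ i p, dy (f i) p = ∑ j, B i j p * f j p)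
    (ht : ∀ i p, dt (f i) p = ∑ j, C i j p * f j p) (i : ι) : ContDiff ℝ ∞ (f i) := by
  rw [contDiff_infty]
  intro n
  induction n generalizing i with
  | zero => exact contDiff_zero.2 (hf i).continuous
  | succ n ih =>
    have key : ∀ A : ι → ι → Space → ℂ, (∀ i j, ContDiff ℝ ∞ (A i j)) →
        ContDiff ℝ n fun p => ∑ j, A i j p * f j p := fun A hA =>
      ContDiff.sum fun j _ => ((hA i j).of_le (by exact_mod_cast le_top)).mul (ih j)
    refine contDiff_succ_of_partials (hf i) ?_ ?_ ?_
    · rw [funext (hx i)]; exact key A hA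
    · rw [funext (hy i)]; exact key B hB
    · rw [funext (ht i)]; exact key C hC

theorem contDiff_laxU {q : Space → ℂ} (hq : ContDiff ℝ ∞ q) (z : ℂ) (i j : Fin 2) :
    ContDiff ℝ ∞ fun p => laxU q z p i j := by
  have h1 := contDiff_conjPot hq
  simp only [laxU_eq]
  fin_cases i <;> fin_cases j <;> simp [redU] <;> fun_prop

theorem contDiff_laxV {q : Space → ℂ} (hq : ContDiff ℝ ∞ q) (z : ℂ) (i j : Fin 2) :
    ContDiff ℝ ∞ fun p => laxV q z p i j := by
  have h1 := contDiff_conjPot hq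
  have h2 := contDiff_dx hq
  have h3 := contDiff_dx h1
  simp only [laxV_eq]
  fin_cases i <;> fin_cases j <;> simp [redV] <;> fun_prop

theorem contDiff_laxW {q : Space → ℂ} (hq : ContDiff ℝ ∞ q) (z : ℂ) (i j : Fin 2) :
    ContDiff ℝ ∞ fun p => laxW q z p i j := by
  have h1 := contDiff_conjPot hq
  have h2 := contDiff_dx hq
  have h3 := contDiff_dx h1
  have h4 := contDiff_dx h2
  have h5 := contDiff_dx h3
  simp only [laxW_eq]
  fin_cases i <;> fin_cases j <;> simp [redW] <;> fun_prop

/-- A smooth vector solution of the Lax system of `q` at the spectral parameter `z`. -/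
structure IsLaxVector (q : Space → ℂ) (z : ℂ) (w : Space → Fin 2 → ℂ) : Prop where
  smooth : ∀ i, ContDiff ℝ ∞ fun p => w p i
  eq_x : ∀ p i, dx (fun s => w s i) p = (laxU q z p *ᵥ w p) i
  eq_y : ∀ p i, dy (fun s => w s i) p = (laxV q z p *ᵥ w p) i
  eq_t : ∀ p i, dt (fun s => w s i) p = (laxW q z p *ᵥ w p) i

theorem fderiv_mulVec {A : Space → Mat2} (hA : DifferentiableMat A) (u : Fin 2 → ℂ) (i : Fin 2)
    (p e : Space) : fderiv ℝ (fun s => (A s *ᵥ u) i) p e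
      = (entrywise (fun f p => fderiv ℝ f p e) A p *ᵥ u) i := by
  simp only [Matrix.mulVec, dotProduct, Fin.sum_univ_two, entrywise, Matrix.of_apply]
  rw [fderiv_fun_add ((hA i 0 p).mul_const _) ((hA i 1 p).mul_const _),
    fderiv_mul_const (hA i 0 p), fderiv_mul_const (hA i 1 p)]
  simp [mul_comm]

theorem IsLaxSolution.isLaxVector {q : Space → ℂ} (hq : ContDiff ℝ ∞ q) {z : ℂ}
    {Ψ : Space → Mat2} (h : IsLaxSolution q z Ψ) (u : Fin 2 → ℂ) :
    IsLaxVector q z fun p => Ψ p *ᵥ u := by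
  have ex : ∀ p i, dx (fun s => (Ψ s *ᵥ u) i) p = (laxU q z p *ᵥ (Ψ p *ᵥ u)) i := fun p i => by
    rw [Matrix.mulVec_mulVec, ← h.eq_x]; exact fderiv_mulVec h.differentiable u i p _
  have ey : ∀ p i, dy (fun s => (Ψ s *ᵥ u) i) p = (laxV q z p *ᵥ (Ψ p *ᵥ u)) i := fun p i => by
    rw [Matrix.mulVec_mulVec, ← h.eq_y]; exact fderiv_mulVec h.differentiable u i p _
  have et : ∀ p i, dt (fun s => (Ψ s *ᵥ u) i) p = (laxW q z p *ᵥ (Ψ p *ᵥ u)) i := fun p i => by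
    rw [Matrix.mulVec_mulVec, ← h.eq_t]; exact fderiv_mulVec h.differentiable u i p _
  refine ⟨?_, ex, ey, et⟩
  refine contDiff_of_linear_system (fun i s => (Ψ s *ᵥ u) i) (fun i => ?_)
    (fun i j p => laxU q z p i j) (fun i j p => laxV q z p i j) (fun i j p => laxW q z p i j)
    (contDiff_laxU hq z) (contDiff_laxV hq z) (contDiff_laxW hq z)
    (fun i p => ex p i) (fun i p => ey p i) (fun i p => et p i)
  simp only [Matrix.mulVec, dotProduct]
  exact Differentiable.fun_sum fun j _ => (h.differentiable i j).mul_const _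

theorem differentiableMat_mul {A B : Space → Mat2} (hA : DifferentiableMat A)
    (hB : DifferentiableMat B) : DifferentiableMat fun p => A p * B p := fun i j => by
  simp only [Matrix.mul_apply]
  exact Differentiable.fun_sum fun k _ => (hA i k).mul (hB k j)

theorem entrywise_fderiv_mul {A B : Space → Mat2} (hA : DifferentiableMat A)
    (hB : DifferentiableMat B) (p e : Space) :
    entrywise (fun f p => fderiv ℝ f p e) (fun p => A p * B p) p
      = entrywise (fun f p => fderiv ℝ f p e) A p * B p
        + A p * entrywise (fun f p => fderiv ℝ f p e) B p := by
  ext i j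
  simp only [entrywise, Matrix.of_apply, Matrix.add_apply, Matrix.mul_apply, Fin.sum_univ_two]
  rw [fderiv_fun_add ((hA i 0 p).fun_mul (hB 0 j p)) ((hA i 1 p).fun_mul (hB 1 j p)),
    fderiv_fun_mul (hA i 0 p) (hB 0 j p), fderiv_fun_mul (hA i 1 p) (hB 1 j p)]
  simp
  ring

theorem IsDarboux.comp {q q' q'' : Space → ℂ} {z : ℂ} {S S' : Space → Mat2}
    (h' : IsDarboux q' q'' z S') (h : IsDarboux q q' z S) :
    IsDarboux q q'' z fun p => S' p * S p := by
  refine ⟨differentiableMat_mul h'.differentiable h.differentiable, fun p => ?_, fun p => ?_,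
    fun p => ?_⟩
  · rw [show entrywise dx (fun p => S' p * S p) p = entrywise dx S' p * S p + S' p * entrywise dx S p
      from entrywise_fderiv_mul h'.differentiable h.differentiable p _, ← mul_assoc, ← h'.eq_x,
      add_mul, mul_assoc (S' p) _ (S p), ← h.eq_x]
    noncomm_ring
  · rw [show entrywise dy (fun p => S' p * S p) p = entrywise dy S' p * S p + S' p * entrywise dy S p
      from entrywise_fderiv_mul h'.differentiable h.differentiable p _, ← mul_assoc, ← h'.eq_y,
      add_mul, mul_assoc (S' p) _ (S p), ← h.eq_y]
    noncomm_ring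
  · rw [show entrywise dt (fun p => S' p * S p) p = entrywise dt S' p * S p + S' p * entrywise dt S p
      from entrywise_fderiv_mul h'.differentiable h.differentiable p _, ← mul_assoc, ← h'.eq_t,
      add_mul, mul_assoc (S' p) _ (S p), ← h.eq_t]
    noncomm_ring

theorem IsDarboux.isLaxSolution {q q' : Space → ℂ} {z : ℂ} {S Ψ : Space → Mat2}
    (h : IsDarboux q q' z S) (hΨ : IsLaxSolution q z Ψ) :
    IsLaxSolution q' z fun p => S p * Ψ p := by
  refine ⟨differentiableMat_mul h.differentiable hΨ.differentiable, fun p => ?_, fun p => ?_,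
    fun p => ?_⟩
  · rw [show entrywise dx (fun p => S p * Ψ p) p = entrywise dx S p * Ψ p + S p * entrywise dx Ψ p
      from entrywise_fderiv_mul h.differentiable hΨ.differentiable p _, hΨ.eq_x, ← mul_assoc,
      ← mul_assoc, ← add_mul, h.eq_x]
  · rw [show entrywise dy (fun p => S p * Ψ p) p = entrywise dy S p * Ψ p + S p * entrywise dy Ψ p
      from entrywise_fderiv_mul h.differentiable hΨ.differentiable p _, hΨ.eq_y, ← mul_assoc,
      ← mul_assoc, ← add_mul, h.eq_y]
  · rw [show entrywise dt (fun p => S p * Ψ p) p = entrywise dt S p * Ψ p + S p * entrywise dt Ψ p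
      from entrywise_fderiv_mul h.differentiable hΨ.differentiable p _, hΨ.eq_t, ← mul_assoc,
      ← mul_assoc, ← add_mul, h.eq_t]

/-- The determinant of a matrix solution is constant, since the Lax matrices are traceless. -/
theorem IsLaxSolution.det_eq {q : Space → ℂ} {z : ℂ} {Ψ : Space → Mat2}
    (h : IsLaxSolution q z Ψ) (p p' : Space) : (Ψ p).det = (Ψ p').det := by
  have hd : Differentiable ℝ fun s => (Ψ s).det := by
    simp only [Matrix.det_fin_two]
    exact ((h.differentiable 0 0).mul (h.differentiable 1 1)).sub
      ((h.differentiable 0 1).mul (h.differentiable 1 0))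
  have key : ∀ (e s : Space) (A : Mat2), A 0 0 + A 1 1 = 0 →
      entrywise (fun f p => fderiv ℝ f p e) Ψ s = A * Ψ s →
      fderiv ℝ (fun s => (Ψ s).det) s e = 0 := by
    intro e s A hA hE
    have hE' : ∀ i j, fderiv ℝ (fun s => Ψ s i j) s e = A i 0 * Ψ s 0 j + A i 1 * Ψ s 1 j :=
      fun i j => by
        have := congrFun (congrFun hE i) j
        simpa [entrywise, Matrix.mul_apply, Fin.sum_univ_two] using this
    have d := fun i j => h.differentiable i j s
    simp only [Matrix.det_fin_two]
    rw [fderiv_fun_sub ((d 0 0).fun_mul (d 1 1)) ((d 0 1).fun_mul (d 1 0)),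
      fderiv_fun_mul (d 0 0) (d 1 1), fderiv_fun_mul (d 0 1) (d 1 0)]
    simp only [_root_.sub_apply, _root_.add_apply,
      _root_.smul_apply, smul_eq_mul, hE']
    linear_combination (Ψ s 0 0 * Ψ s 1 1 - Ψ s 0 1 * Ψ s 1 0) * hA
  refine is_const_of_fderiv_eq_zero hd (fun s => ?_) p p'
  refine ContinuousLinearMap.ext fun v => ?_
  have hv : v = v.1 • ((1, 0, 0) : Space) + v.2.1 • ((0, 1, 0) : Space)
      + v.2.2 • ((0, 0, 1) : Space) := by
    ext <;> simp
  rw [hv]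
  simp only [map_add, map_smul]
  rw [key _ s _ (by simp [laxU_eq, redU]) (h.eq_x s),
    key _ s _ (by simp [laxV_eq, redV]; ring) (h.eq_y s),
    key _ s _ (by simp [laxW_eq, redW]; ring) (h.eq_t s)]
  simp

end LaxSystem

/-! ### The elementary Darboux transformation of smooth potentials -/

section DarbouxStep

theorem star_dotProduct_self_ne_zero {w : Fin 2 → ℂ} (hw : w ≠ 0) : star w ⬝ᵥ w ≠ 0 := by
  open scoped ComplexOrder in
  exact fun h => hw (dotProduct_star_self_eq_zero.1 h)

/-- The reciprocal of a nowhere vanishing smooth function. -/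
noncomputable def invS (f : smoothAlg) (hf : ∀ p, evalAt p f ≠ 0) : smoothAlg :=
  ⟨fun p => (evalAt p f)⁻¹, (contDiff_coe f).inv hf⟩

theorem evalAt_invS (f : smoothAlg) (hf : ∀ p, evalAt p f ≠ 0) (p : Space) :
    evalAt p (invS f hf) = (evalAt p f)⁻¹ := rfl

theorem redDer_algebraMap (e : Space) (c : ℂ) : redDer e (algebraMap ℂ smoothAlg c) = 0 :=
  (redDer e).map_algebraMap c

theorem fderiv_eq_redDer (e p : Space) (f : smoothAlg) :
    fderiv ℝ (f : Space → ℂ) p e = Complex.I * evalAt p (redDer e f) := by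
  rw [evalAt_redDer]
  linear_combination fderiv ℝ (f : Space → ℂ) p e * Complex.I_mul_I

/-- Passage from the gauge identities in the algebra of smooth functions to the Darboux
transformation at a point. -/
theorem eval_gauge (e : Space) (P A B : Matrix (Fin 2) (Fin 2) smoothAlg) (μ m z : ℂ)
    (hz : z ≠ m)
    (h : ∀ i j, -(algebraMap ℂ smoothAlg μ - algebraMap ℂ smoothAlg m) * redDer e (P i j)
      + (IsDressing.gauge (algebraMap ℂ _ μ) (algebraMap ℂ _ m) P (algebraMap ℂ _ z) * A
        - B * IsDressing.gauge (algebraMap ℂ _ μ) (algebraMap ℂ _ m) P (algebraMap ℂ _ z)) i j = 0)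
    (S : Space → Mat2) (hS : ∀ s, S s = 1 - ((μ - m) / (z - m)) • P.map (evalAt s))
    (p : Space) (L L' : Mat2) (hL : L = Complex.I • A.map (evalAt p))
    (hL' : L' = Complex.I • B.map (evalAt p)) :
    entrywise (fun f p => fderiv ℝ f p e) S p + S p * L = L' * S p := by
  have hzm : z - m ≠ 0 := sub_ne_zero.2 hz
  have hder : entrywise (fun f p => fderiv ℝ f p e) S p
      = -(((μ - m) / (z - m)) * Complex.I) • Matrix.of fun i j => evalAt p (redDer e (P i j)) := by
    ext i j
    simp only [entrywise, Matrix.of_apply, Matrix.smul_apply, smul_eq_mul]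
    have : (fun s => S s i j) = fun s => (1 : Mat2) i j - ((μ - m) / (z - m)) *
        (P i j : Space → ℂ) s := by
      funext s; rw [hS]; rfl
    rw [this, fderiv_const_sub, fderiv_const_mul (differentiable_coe _ p)]
    simp only [_root_.neg_apply, _root_.smul_apply, smul_eq_mul, fderiv_eq_redDer]
    ring
  have hg : S p = (z - m)⁻¹ •
      (IsDressing.gauge (algebraMap ℂ _ μ) (algebraMap ℂ _ m) P (algebraMap ℂ _ z)).map
        (evalAt p) := by
    rw [hS]
    ext i j
    fin_cases i <;> fin_cases j <;> simp [IsDressing.gauge] <;> field_simp <;> ring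
  have h' : -(μ - m) • (Matrix.of fun i j => evalAt p (redDer e (P i j)))
      + ((IsDressing.gauge (algebraMap ℂ _ μ) (algebraMap ℂ _ m) P (algebraMap ℂ _ z)).map
          (evalAt p) * A.map (evalAt p)
        - B.map (evalAt p) * (IsDressing.gauge (algebraMap ℂ _ μ) (algebraMap ℂ _ m) P
          (algebraMap ℂ _ z)).map (evalAt p)) = 0 := by
    ext i j
    have := congrArg (evalAt p) (h i j)
    simpa [Matrix.mul_apply, Fin.sum_univ_two] using this
  rw [hder, hg, hL, hL', ← sub_eq_zero, ← smul_zero ((z - m)⁻¹ * Complex.I), ← h']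
  simp only [Matrix.smul_mul, Matrix.mul_smul, smul_add, smul_sub, smul_smul]
  match_scalars <;> field_simp

theorem laxU_coe (f : smoothAlg) (z : ℂ) (p : Space) :
    laxU f z p = Complex.I • (redU f (conjS f) (algebraMap ℂ _ z)).map (evalAt p) := by
  rw [laxU_eq]
  congr 1
  ext i j
  fin_cases i <;> fin_cases j <;> simp [redU] <;> rfl

theorem evalAt_redDer_redDer (e p : Space) (f : smoothAlg) :
    evalAt p (redDer e (redDer e f)) = -fderiv ℝ (fun s => fderiv ℝ (f : Space → ℂ) s e) p e := by
  have : redDer e (redDer e f) = -partialDer e (partialDer e f) := by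
    simp [redDer, smul_smul]
  rw [this]; rfl

theorem evalAt_redDer_redDer_redDer (e p : Space) (f : smoothAlg) :
    evalAt p (redDer e (redDer e (redDer e f))) = Complex.I *
      fderiv ℝ (fun s => fderiv ℝ (fun s => fderiv ℝ (f : Space → ℂ) s e) s e) p e := by
  have : redDer e (redDer e (redDer e f))
      = Complex.I • partialDer e (partialDer e (partialDer e f)) := by
    simp [redDer, smul_smul]
  rw [this]; rfl

theorem laxV_coe (f : smoothAlg) (z : ℂ) (p : Space) :
    laxV f z p = Complex.I • (redV f (conjS f) (redDer (1, 0, 0) f)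
      (redDer (1, 0, 0) (conjS f)) (algebraMap ℂ _ z)).map (evalAt p) := by
  rw [laxV_eq]
  congr 1
  ext i j
  fin_cases i <;> fin_cases j <;> simp [redV, evalAt_redDer] <;> rfl

theorem laxW_coe (f : smoothAlg) (z : ℂ) (p : Space) :
    laxW f z p = Complex.I • (redW f (conjS f) (redDer (1, 0, 0) f)
      (redDer (1, 0, 0) (conjS f)) (redDer (1, 0, 0) (redDer (1, 0, 0) f))
      (redDer (1, 0, 0) (redDer (1, 0, 0) (conjS f))) (algebraMap ℂ _ z)).map (evalAt p) := by
  have h : evalAt p f = (f : Space → ℂ) p := rfl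
  have h0 : evalAt p (conjS f) = conjPot f p := rfl
  have h1 : evalAt p (redDer (1, 0, 0) f) = -Complex.I * dx f p := rfl
  have h2 : evalAt p (redDer (1, 0, 0) (conjS f)) = -Complex.I * dx (conjPot f) p := rfl
  have h3 : evalAt p (redDer (1, 0, 0) (redDer (1, 0, 0) f)) = -dx (dx f) p :=
    evalAt_redDer_redDer _ _ _
  have h4 : evalAt p (redDer (1, 0, 0) (redDer (1, 0, 0) (conjS f))) = -dx (dx (conjPot f)) p :=
    evalAt_redDer_redDer _ _ _
  rw [laxW_eq]
  congr 1
  ext i j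
  fin_cases i <;> fin_cases j <;>
    simp [redW, h, h0, h1, h2, h3, h4, map_ofNat]
  ring

/-- The second flow, written in the algebra of smooth functions. -/
theorem secondFlow_iff (f g : smoothAlg) : SecondFlow f g ↔
    redDer (0, 1, 0) f = -redDer (1, 0, 0) (redDer (1, 0, 0) f) + 2 * f ^ 2 * g ∧
    redDer (0, 1, 0) g = redDer (1, 0, 0) (redDer (1, 0, 0) g) - 2 * f * g ^ 2 := by
  have e1 : ∀ p, evalAt p (redDer (0, 1, 0) f)
      - evalAt p (-redDer (1, 0, 0) (redDer (1, 0, 0) f) + 2 * f ^ 2 * g)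
      = -(Complex.I * dy f p - (-dx (dx f) p - 2 * (f : Space → ℂ) p ^ 2 * (g : Space → ℂ) p)) := by
    intro p
    simp only [evalAt_redDer_redDer, map_add, map_neg, map_mul, map_pow, map_ofNat]
    simp only [evalAt_redDer]
    simp only [evalAt_apply]
    unfold dx dy
    ring
  have e2 : ∀ p, evalAt p (redDer (0, 1, 0) g)
      - evalAt p (redDer (1, 0, 0) (redDer (1, 0, 0) g) - 2 * f * g ^ 2)
      = -(Complex.I * dy g p - (dx (dx g) p + 2 * (f : Space → ℂ) p * (g : Space → ℂ) p ^ 2)) := by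
    intro p
    simp only [evalAt_redDer_redDer, map_sub, map_mul, map_pow, map_ofNat]
    simp only [evalAt_redDer]
    simp only [evalAt_apply]
    unfold dx dy
    ring
  constructor
  · intro h
    refine ⟨smoothAlg_ext fun p => ?_, smoothAlg_ext fun p => ?_⟩
    · rw [← sub_eq_zero, e1, neg_eq_zero, sub_eq_zero]; exact (h p).1
    · rw [← sub_eq_zero, e2, neg_eq_zero, sub_eq_zero]; exact (h p).2
  · rintro ⟨h1, h2⟩ p
    refine ⟨?_, ?_⟩
    · rw [← sub_eq_zero, ← neg_eq_zero, ← e1, h1, sub_self]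
    · rw [← sub_eq_zero, ← neg_eq_zero, ← e2, h2, sub_self]

/-- The third flow, written in the algebra of smooth functions. -/
theorem thirdFlow_iff (f g : smoothAlg) : ThirdFlow f g ↔
    redDer (0, 0, 1) f = -redDer (1, 0, 0) (redDer (1, 0, 0) (redDer (1, 0, 0) f))
      + 6 * f * g * redDer (1, 0, 0) f ∧
    redDer (0, 0, 1) g = -redDer (1, 0, 0) (redDer (1, 0, 0) (redDer (1, 0, 0) g))
      + 6 * f * g * redDer (1, 0, 0) g := by
  have e : ∀ (F : smoothAlg) (p : Space), evalAt p (redDer (0, 0, 1) F)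
      - evalAt p (-redDer (1, 0, 0) (redDer (1, 0, 0) (redDer (1, 0, 0) F))
        + 6 * f * g * redDer (1, 0, 0) F)
      = -Complex.I * (dt F p - (dx (dx (dx F)) p
        + 6 * dx F p * (f : Space → ℂ) p * (g : Space → ℂ) p)) := by
    intro F p
    simp only [evalAt_redDer_redDer_redDer, map_add, map_neg, map_mul, map_ofNat]
    simp only [evalAt_redDer]
    simp only [evalAt_apply]
    unfold dx dt
    ring
  have hI : -Complex.I ≠ 0 := neg_ne_zero.2 Complex.I_ne_zero
  constructor
  · intro h
    refine ⟨smoothAlg_ext fun p => ?_, smoothAlg_ext fun p => ?_⟩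
    · rw [← sub_eq_zero, e, (h p).1, sub_self, mul_zero]
    · rw [← sub_eq_zero, e, (h p).2]; ring
  · rintro ⟨h1, h2⟩ p
    have k1 := e f p
    have k2 := e g p
    rw [h1, sub_self, eq_comm, mul_eq_zero, or_iff_right hI, sub_eq_zero] at k1
    rw [h2, sub_self, eq_comm, mul_eq_zero, or_iff_right hI, sub_eq_zero] at k2
    exact ⟨k1, by rw [k2]; ring⟩

theorem kp_of_redDer (f : smoothAlg)
    (h : redDer (1, 0, 0) (4 * redDer (0, 0, 1) f - 12 * f * redDer (1, 0, 0) f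
      + redDer (1, 0, 0) (redDer (1, 0, 0) (redDer (1, 0, 0) f)))
      + 3 * redDer (0, 1, 0) (redDer (0, 1, 0) f) = 0) : KP f := by
  intro p
  have key : 4 * redDer (0, 0, 1) f - 12 * f * redDer (1, 0, 0) f
      + redDer (1, 0, 0) (redDer (1, 0, 0) (redDer (1, 0, 0) f))
      = (-Complex.I) • (4 * partialDer (0, 0, 1) f - 12 * f * partialDer (1, 0, 0) f
        - partialDer (1, 0, 0) (partialDer (1, 0, 0) (partialDer (1, 0, 0) f))) := by
    simp only [redDer, Derivation.smul_apply, Derivation.map_smul, smul_smul, smul_sub,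
      mul_smul_comm]
    simp only [Complex.I_mul_I, neg_mul, mul_neg]
    simp [sub_eq_add_neg]
  rw [key] at h
  have h2 := congrArg (evalAt p) h
  rw [map_add, Derivation.map_smul, map_smul, map_mul, evalAt_redDer_redDer, map_ofNat,
    evalAt_redDer, map_zero] at h2
  have h3 : -Complex.I * (-Complex.I * fderiv ℝ (fun s => 4 * dt f s
      - 12 * (f : Space → ℂ) s * dx f s - dx (dx (dx f)) s) p (1, 0, 0))
      + 3 * -dy (dy f) p = 0 := h2
  rw [← mul_assoc, neg_mul_neg, Complex.I_mul_I] at h3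
  change fderiv ℝ (fun s => 4 * dt f s - 12 * (f : Space → ℂ) s * dx f s - dx (dx (dx f)) s) p
      (1, 0, 0) + 3 * dy (dy f) p = 0
  linear_combination -h3

/-- The equation of the second flow for `q^*` is the conjugate of the one for `q`. -/
theorem secondFlow_conj (f : smoothAlg)
    (h : redDer (0, 1, 0) f
      = -redDer (1, 0, 0) (redDer (1, 0, 0) f) + 2 * f ^ 2 * conjS f) :
    redDer (0, 1, 0) (conjS f)
      = redDer (1, 0, 0) (redDer (1, 0, 0) (conjS f)) - 2 * f * conjS f ^ 2 := by
  rw [redDer_conjS, redDer_conjS, map_neg, redDer_conjS, h]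
  simp only [map_add, map_neg, map_mul, map_pow, map_ofNat, conjS_conjS]
  ring

/-- The equation of the third flow for `q^*` is the conjugate of the one for `q`. -/
theorem thirdFlow_conj (f : smoothAlg)
    (h : redDer (0, 0, 1) f = -redDer (1, 0, 0) (redDer (1, 0, 0) (redDer (1, 0, 0) f))
      + 6 * f * conjS f * redDer (1, 0, 0) f) :
    redDer (0, 0, 1) (conjS f)
      = -redDer (1, 0, 0) (redDer (1, 0, 0) (redDer (1, 0, 0) (conjS f)))
        + 6 * f * conjS f * redDer (1, 0, 0) (conjS f) := by
  rw [redDer_conjS, redDer_conjS, map_neg, redDer_conjS, neg_neg, redDer_conjS, h]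
  simp only [map_add, map_neg, map_mul, map_ofNat, conjS_conjS]
  ring

/-- The second and third flows imply the KP equation for `q q^*`. -/
theorem kp_of_secondFlow_of_thirdFlow {q : Space → ℂ} (hq : ContDiff ℝ ∞ q)
    (h2 : SecondFlow q (conjPot q)) (h3 : ThirdFlow q (conjPot q)) :
    KP fun p => q p * conjPot q p := by
  let f : smoothAlg := ⟨q, hq⟩
  have h2' := (secondFlow_iff f (conjS f)).1 h2
  have h3' := (thirdFlow_iff f (conjS f)).1 h3
  exact kp_of_redDer (f * conjS f)
    (kp_of_flows _ _ _ (redDer_comm _ _) f (conjS f) h2'.1 h2'.2 h3'.1 h3'.2)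

theorem redDer_component (e : Space) (A : Matrix (Fin 2) (Fin 2) smoothAlg)
    (w : Fin 2 → smoothAlg) (L : Space → Mat2)
    (hL : ∀ p, L p = Complex.I • A.map (evalAt p))
    (hw : ∀ p i, fderiv ℝ (w i : Space → ℂ) p e = (L p *ᵥ fun i => evalAt p (w i)) i) (i : Fin 2) :
    redDer e (w i) = A i 0 * w 0 + A i 1 * w 1 := by
  refine smoothAlg_ext fun p => ?_
  rw [evalAt_redDer, hw, hL]
  simp only [Matrix.mulVec, dotProduct, Fin.sum_univ_two, Matrix.smul_apply, Matrix.map_apply,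
    smul_eq_mul, map_add, map_mul]
  linear_combination (-(evalAt p (A i 0) * evalAt p (w 0) + evalAt p (A i 1) * evalAt p (w 1)))
    * Complex.I_mul_I

/-- If `w` solves a linear system, then `w†` solves the adjoint one. -/
theorem redDer_conj_component (e : Space) (A B : Matrix (Fin 2) (Fin 2) smoothAlg)
    (w : Fin 2 → smoothAlg) (hAB : ∀ i j, conjS (A i j) = B j i)
    (hw : ∀ i, redDer e (w i) = A i 0 * w 0 + A i 1 * w 1) (j : Fin 2) :
    redDer e (conjS (w j)) = -(conjS (w 0) * B 0 j + conjS (w 1) * B 1 j) := by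
  rw [redDer_conjS, hw, map_add, map_mul, map_mul, hAB, hAB]
  ring

/-- The symmetry `(-i U(z))† = -i U(z^*)`, which holds since `r = q^*`. -/
theorem conjS_redU (f : smoothAlg) (z : ℂ) (i j : Fin 2) :
    conjS (redU f (conjS f) (algebraMap ℂ _ z) i j)
      = redU f (conjS f) (algebraMap ℂ _ (conj z)) j i := by
  fin_cases i <;> fin_cases j <;> simp [redU, conjS_conjS, conjS_algebraMap]

theorem conjS_redV (f : smoothAlg) (e : Space) (z : ℂ) (i j : Fin 2) :
    conjS (redV f (conjS f) (redDer e f) (redDer e (conjS f)) (algebraMap ℂ _ z) i j)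
      = redV f (conjS f) (redDer e f) (redDer e (conjS f)) (algebraMap ℂ _ (conj z)) j i := by
  fin_cases i <;> fin_cases j <;>
    simp [redV, conjS_conjS, conjS_algebraMap, redDer_conjS, map_ofNat] <;> ring

theorem conjS_redW (f : smoothAlg) (e : Space) (z : ℂ) (i j : Fin 2) :
    conjS (redW f (conjS f) (redDer e f) (redDer e (conjS f)) (redDer e (redDer e f))
        (redDer e (redDer e (conjS f))) (algebraMap ℂ _ z) i j)
      = redW f (conjS f) (redDer e f) (redDer e (conjS f)) (redDer e (redDer e f))
        (redDer e (redDer e (conjS f))) (algebraMap ℂ _ (conj z)) j i := by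
  fin_cases i <;> fin_cases j <;>
    simp [redW, conjS_conjS, conjS_algebraMap, redDer_conjS, map_ofNat] <;> ring

/-- One elementary Darboux transformation, built from a nowhere vanishing vector solution. -/
theorem darboux_step {q : Space → ℂ} (hq : ContDiff ℝ ∞ q)
    (h2 : SecondFlow q (conjPot q)) (h3 : ThirdFlow q (conjPot q))
    {μ : ℂ} {w : Space → Fin 2 → ℂ} (hw : IsLaxVector q μ w) (hw0 : ∀ p, w p ≠ 0)
    {q' : Space → ℂ} (hq' : ∀ p, q' p = elemPot μ (w p) (q p)) :
    ContDiff ℝ ∞ q' ∧ SecondFlow q' (conjPot q') ∧ ThirdFlow q' (conjPot q') ∧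
      ∀ z, z ≠ conj μ → IsDarboux q q' z fun p => elemT μ (w p) z := by
  let f : smoothAlg := ⟨q, hq⟩
  let ws : Fin 2 → smoothAlg := fun i => ⟨fun p => w p i, hw.smooth i⟩
  have hn : ∀ p, evalAt p (ws 0 * conjS (ws 0) + ws 1 * conjS (ws 1)) = star (w p) ⬝ᵥ w p := by
    intro p
    simp only [dotProduct, Fin.sum_univ_two, map_add, map_mul, evalAt_conjS, Pi.star_apply]
    simp only [evalAt_apply, ws, RCLike.star_def]
    ring
  have hn0 : ∀ p, evalAt p (ws 0 * conjS (ws 0) + ws 1 * conjS (ws 1)) ≠ 0 := fun p => by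
    rw [hn]; exact star_dotProduct_self_ne_zero (hw0 p)
  let ν := invS _ hn0
  have hν : ν * (ws 0 * conjS (ws 0) + ws 1 * conjS (ws 1)) = 1 :=
    smoothAlg_ext fun p => by
      rw [map_mul, map_one]; exact inv_mul_cancel₀ (hn0 p)
  let P : Matrix (Fin 2) (Fin 2) smoothAlg := Matrix.of fun i j => ws i * conjS (ws j) * ν
  let M : smoothAlg := algebraMap ℂ _ μ
  let m : smoothAlg := algebraMap ℂ _ (conj μ)
  have hx := redDer_component (1, 0, 0) _ ws _ (laxU_coe f μ) hw.eq_x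
  have hy := redDer_component (0, 1, 0) _ ws _ (laxV_coe f μ) hw.eq_y
  have ht := redDer_component (0, 0, 1) _ ws _ (laxW_coe f μ) hw.eq_t
  have hP : IsDressing (redDer (1, 0, 0)) (redDer (0, 1, 0)) (redDer (0, 0, 1)) f (conjS f) M m P :=
    isDressing_projector _ _ _ f (conjS f) M m ws (fun j => conjS (ws j)) ν hν
      hx (redDer_conj_component _ _ _ ws (conjS_redU f μ) hx)
      hy (redDer_conj_component _ _ _ ws (conjS_redV f _ μ) hy)
      ht (redDer_conj_component _ _ _ ws (conjS_redW f _ μ) ht)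
  let g : smoothAlg := f - 2 * (M - m) * P 1 0
  have hPc : conjS (P 1 0) = P 0 1 := smoothAlg_ext fun p => by
    simp only [P, ν, Matrix.of_apply, map_mul, evalAt_conjS, evalAt_invS, map_inv₀, map_add,
      Complex.conj_conj]
    ring
  have hgc : conjS g = conjS f + 2 * (M - m) * P 0 1 := by
    simp only [g, M, m, map_sub, map_mul, map_ofNat, conjS_algebraMap, Complex.conj_conj, hPc]
    ring
  have hPe : ∀ p i j, evalAt p (P i j) = (star (w p) ⬝ᵥ w p)⁻¹ * (w p i * conj (w p j)) := by
    intro p i j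
    simp only [P, ν, Matrix.of_apply, map_mul, evalAt_conjS, evalAt_invS, hn]
    rw [mul_comm]
    rfl
  have hg : q' = g := by
    funext p
    have : (g : Space → ℂ) p = evalAt p g := rfl
    rw [hq', this]
    simp only [g, M, m, map_sub, map_mul, map_ofNat, evalAt_const, hPe, elemPot]
    rw [show evalAt p f = q p from rfl]
    ring
  have hXM := redDer_algebraMap (1, 0, 0) μ
  have hXm := redDer_algebraMap (1, 0, 0) (conj μ)
  have h2' := hP.second_flow hXM hXm (redDer_algebraMap _ _) (redDer_algebraMap _ _)
    ((secondFlow_iff f (conjS f)).1 h2).1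
  have h3' := hP.third_flow hXM hXm (redDer_algebraMap _ _) (redDer_algebraMap _ _)
    ((thirdFlow_iff f (conjS f)).1 h3).1
  rw [← hgc] at h2' h3'
  refine ⟨hg ▸ contDiff_coe g, hg ▸ (secondFlow_iff g (conjS g)).2 ⟨h2', secondFlow_conj g h2'⟩,
    hg ▸ (thirdFlow_iff g (conjS g)).2 ⟨h3', thirdFlow_conj g h3'⟩, fun z hz => ?_⟩
  have hS : ∀ s, elemT μ (w s) z = 1 - ((μ - conj μ) / (z - conj μ)) • P.map (evalAt s) := by
    intro s
    rw [elemT]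
    congr 2
    ext i j
    rw [Matrix.map_apply, hPe]
    rfl
  have gx := fun i j => hP.gauge_x (algebraMap ℂ _ z) i j
  have gy := fun i j => hP.gauge_y hXM hXm (algebraMap ℂ _ z) i j
  have gt := fun i j => hP.gauge_t hXM hXm (algebraMap ℂ _ z) i j
  rw [← hgc] at gx gy gt
  rw [hg]
  refine ⟨fun i j => ?_, fun p => ?_, fun p => ?_, fun p => ?_⟩
  · simp only [hS]
    exact ((differentiable_coe (P i j)).const_mul _).const_sub _
  · exact eval_gauge _ P _ _ μ (conj μ) z hz gx _ hS p _ _ (laxU_coe f z p) (laxU_coe g z p)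
  · exact eval_gauge _ P _ _ μ (conj μ) z hz gy _ hS p _ _ (laxV_coe f z p) (laxV_coe g z p)
  · exact eval_gauge _ P _ _ μ (conj μ) z hz gt _ hS p _ _ (laxW_coe f z p) (laxW_coe g z p)

end DarbouxStep

/-! ### Iterated Darboux matrices at a fixed point -/

section PointwiseAlgebra

/-- The orthogonal projector onto the line spanned by `w` (zero if `w = 0`). -/
noncomputable def lineProj (w : Fin 2 → ℂ) : Mat2 := (star w ⬝ᵥ w)⁻¹ • Matrix.vecMulVec w (star w)

theorem lineProj_conjTranspose (w : Fin 2 → ℂ) : (lineProj w)ᴴ = lineProj w := by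
  have hn : star (star w ⬝ᵥ w) = star w ⬝ᵥ w := by
    rw [← Matrix.star_dotProduct_star, star_star]
  rw [lineProj, Matrix.conjTranspose_smul, Matrix.conjTranspose_vecMulVec, star_star, star_inv₀, hn]

theorem lineProj_mulVec_self {w : Fin 2 → ℂ} (hw : w ≠ 0) : lineProj w *ᵥ w = w := by
  rw [lineProj, Matrix.smul_mulVec, Matrix.vecMulVec_mulVec, op_smul_eq_smul, smul_smul,
    inv_mul_cancel₀ (star_dotProduct_self_ne_zero hw), one_smul]

theorem lineProj_mul_self (w : Fin 2 → ℂ) : lineProj w * lineProj w = lineProj w := by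
  -- for `w = 0` the definition yields the zero matrix
  by_cases hw : w = 0
  · simp [lineProj, hw]
  · conv_lhs => rw [lineProj.eq_1 w, Matrix.mul_smul, Matrix.mul_vecMulVec]
    change _ • Matrix.vecMulVec (lineProj w *ᵥ w) _ = _
    rw [lineProj_mulVec_self hw]
    rfl

theorem lineProj_smul (w : Fin 2 → ℂ) {c : ℂ} (hc : c ≠ 0) : lineProj (c • w) = lineProj w := by
  have hc' : star c ≠ 0 := star_ne_zero.2 hc
  rw [lineProj, lineProj, star_smul, Matrix.smul_vecMulVec, Matrix.vecMulVec_smul, smul_dotProduct,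
    dotProduct_smul, smul_smul, smul_smul]
  congr 1
  simp only [smul_eq_mul, mul_inv]
  field_simp

theorem elemT_eq (μ : ℂ) (w : Fin 2 → ℂ) (z : ℂ) :
    elemT μ w z = 1 - ((μ - conj μ) / (z - conj μ)) • lineProj w := rfl

/-- The elementary Darboux matrix satisfies `E(z^*)† E(z) = I`. -/
theorem elemT_conjTranspose_mul (μ : ℂ) (w : Fin 2 → ℂ) {z : ℂ} (h1 : z ≠ conj μ) (h2 : z ≠ μ) :
    (elemT μ w (conj z))ᴴ * elemT μ w z = 1 := by
  have h1' := sub_ne_zero.2 h1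
  have h2' := sub_ne_zero.2 h2
  have hs : star ((μ - conj μ) / (conj z - conj μ)) = (conj μ - μ) / (z - μ) := by
    simp
  have hk : (conj μ - μ) / (z - μ) * ((μ - conj μ) / (z - conj μ))
      = (μ - conj μ) / (z - conj μ) + (conj μ - μ) / (z - μ) := by
    field_simp
    ring
  rw [elemT_eq, elemT_eq, Matrix.conjTranspose_sub, Matrix.conjTranspose_one,
    Matrix.conjTranspose_smul, lineProj_conjTranspose, hs, sub_mul, one_mul, mul_sub, mul_one,
    Matrix.smul_mul, Matrix.mul_smul, lineProj_mul_self, smul_smul, hk, add_smul]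
  abel

theorem elemT_mulVec_self (μ : ℂ) (hμ : conj μ ≠ μ) {w : Fin 2 → ℂ} (hw : w ≠ 0) :
    elemT μ w μ *ᵥ w = 0 := by
  rw [elemT_eq, div_self (sub_ne_zero.2 hμ.symm), one_smul, Matrix.sub_mulVec,
    lineProj_mulVec_self hw, Matrix.one_mulVec, sub_self]

theorem elemT_smul (μ : ℂ) (w : Fin 2 → ℂ) {c : ℂ} (hc : c ≠ 0) (z : ℂ) :
    elemT μ (c • w) z = elemT μ w z := by
  rw [elemT_eq, elemT_eq, lineProj_smul w hc]

theorem elemPot_eq (μ : ℂ) (w : Fin 2 → ℂ) (q₀ : ℂ) :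
    elemPot μ w q₀ = q₀ - 2 * (μ - conj μ) * lineProj w 1 0 := by
  rw [elemPot, lineProj, Matrix.smul_apply, Matrix.vecMulVec_apply, div_eq_inv_mul]
  rfl

theorem elemPot_smul (μ : ℂ) (w : Fin 2 → ℂ) {c : ℂ} (hc : c ≠ 0) (q₀ : ℂ) :
    elemPot μ (c • w) q₀ = elemPot μ w q₀ := by
  rw [elemPot_eq, elemPot_eq, lineProj_smul w hc]

theorem iterT_smul (N : ℕ) (lam : Fin N → ℂ) (v : Fin N → Fin 2 → ℂ) (c : Fin N → ℂ)
    (hc : ∀ i, c i ≠ 0) (z : ℂ) : iterT N lam (fun i => c i • v i) z = iterT N lam v z := by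
  induction N generalizing z with
  | zero => rfl
  | succ n ih =>
    simp only [iterT]
    rw [ih _ _ (fun i => c i.castSucc) (fun i => hc _),
      ih _ _ (fun i => c i.castSucc) (fun i => hc _), Matrix.mulVec_smul, elemT_smul _ _ (hc _)]

theorem iterPot_smul (N : ℕ) (lam : Fin N → ℂ) (v : Fin N → Fin 2 → ℂ) (c : Fin N → ℂ)
    (hc : ∀ i, c i ≠ 0) (q₀ : ℂ) :
    iterPot N lam (fun i => c i • v i) q₀ = iterPot N lam v q₀ := by
  induction N generalizing q₀ with
  | zero => rfl
  | succ n ih =>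
    simp only [iterPot]
    rw [ih _ _ (fun i => c i.castSucc) (fun i => hc _),
      iterT_smul _ _ _ (fun i => c i.castSucc) (fun i => hc _), Matrix.mulVec_smul,
      elemPot_smul _ _ (hc _)]

theorem iterT_conjTranspose_mul (N : ℕ) (lam : Fin N → ℂ) (v : Fin N → Fin 2 → ℂ) {z : ℂ}
    (h1 : ∀ i, z ≠ conj (lam i)) (h2 : ∀ i, z ≠ lam i) :
    (iterT N lam v (conj z))ᴴ * iterT N lam v z = 1 := by
  induction N with
  | zero => simp [iterT]
  | succ n ih =>
    rw [iterT, iterT, Matrix.conjTranspose_mul, mul_assoc, ← mul_assoc (elemT _ _ _)ᴴ,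
      elemT_conjTranspose_mul _ _ (h1 _) (h2 _), one_mul]
    exact ih _ _ (fun i => h1 _) (fun i => h2 _)

theorem isUnit_det_iterT (N : ℕ) (lam : Fin N → ℂ) (v : Fin N → Fin 2 → ℂ) {z : ℂ}
    (h1 : ∀ i, z ≠ conj (lam i)) (h2 : ∀ i, z ≠ lam i) : IsUnit (iterT N lam v z).det :=
  Matrix.isUnit_det_of_left_inverse (iterT_conjTranspose_mul N lam v h1 h2)

theorem iterT_mulVec_ne_zero {n : ℕ} (lam : Fin (n + 1) → ℂ) (hinj : Function.Injective lam)
    (hconj : ∀ i j, conj (lam i) ≠ lam j) (v : Fin (n + 1) → Fin 2 → ℂ) (hv : ∀ i, v i ≠ 0) :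
    iterT n (fun i => lam i.castSucc) (fun i => v i.castSucc) (lam (Fin.last n))
      *ᵥ v (Fin.last n) ≠ 0 := by
  intro h
  refine hv (Fin.last n) ?_
  have hu := isUnit_det_iterT n (fun i => lam i.castSucc) (fun i => v i.castSucc)
    (z := lam (Fin.last n)) (fun i => (hconj _ _).symm)
    (fun i h => (Fin.castSucc_lt_last i).ne' (hinj h))
  exact Matrix.mulVec_injective_of_isUnit ((Matrix.isUnit_iff_isUnit_det _).2 hu)
    (h.trans (Matrix.mulVec_zero _).symm)

/-- The iterated Darboux matrix annihilates `v_k` at the `k`-th spectral parameter. -/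
theorem iterT_mulVec_eq_zero (N : ℕ) (lam : Fin N → ℂ) (hinj : Function.Injective lam)
    (hconj : ∀ i j, conj (lam i) ≠ lam j) (v : Fin N → Fin 2 → ℂ) (hv : ∀ i, v i ≠ 0)
    (k : Fin N) : iterT N lam v (lam k) *ᵥ v k = 0 := by
  induction N with
  | zero => exact k.elim0
  | succ n ih =>
    rw [iterT, ← Matrix.mulVec_mulVec]
    induction k using Fin.lastCases with
    | last => exact elemT_mulVec_self _ (hconj _ _) (iterT_mulVec_ne_zero lam hinj hconj v hv)
    | cast k =>
      rw [ih (fun i => lam i.castSucc) (hinj.comp (Fin.castSucc_injective n))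
        (fun i j => hconj _ _) (fun i => v i.castSucc) (fun i => hv _) k, Matrix.mulVec_zero]

/-- Partial fractions: the iterated Darboux matrix has simple poles at `λ_j^*` whose residues
are of the form `x_j v_j†`; the sum of the residues gives the potential. -/
theorem exists_iterT_eq (N : ℕ) (lam : Fin N → ℂ) (hinj : Function.Injective lam)
    (hconj : ∀ i j, conj (lam i) ≠ lam j) (v : Fin N → Fin 2 → ℂ) (hv : ∀ i, v i ≠ 0) :
    ∃ x : Fin N → Fin 2 → ℂ,
      (∀ z, (∀ i, z ≠ conj (lam i)) → iterT N lam v z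
        = 1 + ∑ j, (z - conj (lam j))⁻¹ • Matrix.vecMulVec (x j) (star (v j))) ∧
      ∀ q₀, iterPot N lam v q₀ = q₀ + 2 * ∑ j, x j 1 * conj (v j 0) := by
  induction N with
  | zero => exact ⟨fun i => i.elim0, fun z _ => by simp [iterT], fun q₀ => by simp [iterPot]⟩
  | succ n ih =>
    obtain ⟨x, hx, hxp⟩ := ih (fun i => lam i.castSucc) (hinj.comp (Fin.castSucc_injective n))
      (fun i j => hconj _ _) (fun i => v i.castSucc) (fun i => hv _)
    set μ := lam (Fin.last n) with hμ
    set w := iterT n (fun i => lam i.castSucc) (fun i => v i.castSucc) μ *ᵥ v (Fin.last n) with hw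
    have hw0 : w ≠ 0 := iterT_mulVec_ne_zero lam hinj hconj v hv
    have hμj : ∀ j : Fin n, conj μ ≠ conj (lam j.castSucc) := fun j h =>
      (Fin.castSucc_lt_last j).ne' (hinj ((starRingEnd ℂ).injective h))
    set κ := (μ - conj μ) * (star w ⬝ᵥ w)⁻¹ with hκ
    -- unitarity turns `w† T(μ^*)` into `v†`, which makes the new residue `w v†`
    have hwT : star w ᵥ* iterT n (fun i => lam i.castSucc) (fun i => v i.castSucc) (conj μ)
        = star (v (Fin.last n)) := by
      have := iterT_conjTranspose_mul n (fun i => lam i.castSucc) (fun i => v i.castSucc)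
        (z := conj μ) hμj (fun i => hconj _ _)
      rw [Complex.conj_conj] at this
      rw [hw, Matrix.star_mulVec, Matrix.vecMul_vecMul, this, Matrix.vecMul_one]
    have hsum : ∀ z, star w ᵥ* (1 + ∑ j : Fin n, (z - conj (lam j.castSucc))⁻¹ •
        Matrix.vecMulVec (x j) (star (v j.castSucc)))
        = star w + ∑ j : Fin n, ((z - conj (lam j.castSucc))⁻¹ * (star w ⬝ᵥ x j))
          • star (v j.castSucc) := by
      intro z
      rw [Matrix.vecMul_add, Matrix.vecMul_one, Matrix.vecMul_sum]
      simp only [Matrix.vecMul_smul, Matrix.vecMul_vecMulVec, smul_smul]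
    rw [hx _ hμj, hsum] at hwT
    have hv' : ∀ b, conj (v (Fin.last n) b) = conj (w b) + ∑ j : Fin n,
        (conj μ - conj (lam j.castSucc))⁻¹ * (star w ⬝ᵥ x j) * conj (v j.castSucc b) := by
      intro b
      have := (congrFun hwT b).symm
      simpa [Finset.sum_apply] using this
    refine ⟨Fin.lastCases (-κ • w) fun j => x j + (κ * (conj μ - conj (lam j.castSucc))⁻¹
      * (star w ⬝ᵥ x j)) • w, fun z hz => ?_, fun q₀ => ?_⟩
    · have hE : elemT μ w z = 1 - (κ * (z - conj μ)⁻¹) • Matrix.vecMulVec w (star w) := by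
        rw [elemT, smul_smul, hκ]
        congr 2
        ring
      rw [iterT, ← hμ, ← hw, hE, sub_mul, one_mul, Matrix.smul_mul, Matrix.vecMulVec_mul,
        hx z fun i => hz _, hsum, Fin.sum_univ_castSucc]
      simp only [Fin.lastCases_last, Fin.lastCases_castSucc, ← hμ]
      ext a b
      simp only [Matrix.sub_apply, Matrix.add_apply, Matrix.sum_apply, Matrix.smul_apply,
        Matrix.vecMulVec_apply, Pi.add_apply, Finset.sum_apply, Pi.smul_apply, Pi.star_apply,
        smul_eq_mul, RCLike.star_def, hv']
      -- partial fractions for `1 / ((z - μ^*) (z - λ_j^*))`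
      have hj : ∀ j : Fin n, (z - conj (lam j.castSucc))⁻¹ * ((x j a +
          κ * (conj μ - conj (lam j.castSucc))⁻¹ * (star w ⬝ᵥ x j) * w a) * conj (v j.castSucc b))
          = (z - conj (lam j.castSucc))⁻¹ * (x j a * conj (v j.castSucc b))
            + (κ * (z - conj μ)⁻¹ * w a) * ((conj μ - conj (lam j.castSucc))⁻¹ * (star w ⬝ᵥ x j)
              * conj (v j.castSucc b))
            - (κ * (z - conj μ)⁻¹ * w a) * ((z - conj (lam j.castSucc))⁻¹ * (star w ⬝ᵥ x j)
              * conj (v j.castSucc b)) := by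
        intro j
        have h1 := sub_ne_zero.2 (hμj j)
        have h2 := sub_ne_zero.2 (hz j.castSucc)
        have h3 := sub_ne_zero.2 (hz (Fin.last n))
        rw [← hμ] at h3
        field_simp
        ring
      rw [Finset.sum_congr rfl fun j _ => hj j, Finset.sum_sub_distrib, Finset.sum_add_distrib,
        ← Finset.mul_sum, ← Finset.mul_sum]
      ring
    · rw [iterPot, hxp, Fin.sum_univ_castSucc]
      simp only [Fin.lastCases_last, Fin.lastCases_castSucc, ← hμ, ← hw, elemPot, Pi.add_apply,
        Pi.smul_apply, smul_eq_mul, hv']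
      have hj : ∀ j : Fin n, (x j 1 + κ * (conj μ - conj (lam j.castSucc))⁻¹ * (star w ⬝ᵥ x j)
          * w 1) * conj (v j.castSucc 0) = x j 1 * conj (v j.castSucc 0)
            + κ * w 1 * ((conj μ - conj (lam j.castSucc))⁻¹ * (star w ⬝ᵥ x j)
              * conj (v j.castSucc 0)) := fun j => by ring
      rw [Finset.sum_congr rfl fun j _ => hj j, Finset.sum_add_distrib, ← Finset.mul_sum, hκ,
        div_eq_mul_inv]
      ring

/-- The closed formulas: `M` is invertible, and `T_N` and the potential agree with the iteration.
The columns `x_j` of the residues solve `X M = Y`, because the iterated matrix annihilates `v_k`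
at `λ_k`. The kernel of `M` is contained in that of `Y` and invariant under `diag(λ_j)`, hence it
is trivial. -/
theorem closed_form (N : ℕ) (lam : Fin N → ℂ) (hinj : Function.Injective lam)
    (hconj : ∀ i j, conj (lam i) ≠ lam j) (v : Fin N → Fin 2 → ℂ) (hv : ∀ i, v i ≠ 0) :
    IsUnit (matM lam v).det ∧
      (∀ z, (∀ i, z ≠ conj (lam i)) → darbouxT lam v z = iterT N lam v z) ∧
      ∀ q₀, darbouxPot lam v q₀ = iterPot N lam v q₀ := by
  obtain ⟨x, hx, hxp⟩ := exists_iterT_eq N lam hinj hconj v hv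
  have hXM : matY x * matM lam v = matY v := by
    ext a k
    have h := congrFun (iterT_mulVec_eq_zero N lam hinj hconj v hv k) a
    rw [hx _ fun i => (hconj i k).symm, Matrix.add_mulVec, Matrix.one_mulVec,
      Matrix.sum_mulVec] at h
    simp only [Matrix.smul_mulVec, Matrix.vecMulVec_mulVec, Pi.add_apply, Finset.sum_apply,
      Pi.smul_apply, op_smul_eq_smul, smul_eq_mul, Pi.zero_apply] at h
    rw [add_comm, add_eq_zero_iff_neg_eq, ← Finset.sum_neg_distrib] at h
    rw [Matrix.mul_apply, matY, matY, matM]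
    simp only [Matrix.of_apply]
    rw [← h]
    refine Finset.sum_congr rfl fun j _ => ?_
    rw [← neg_sub (conj (lam j)) (lam k), inv_neg, div_eq_mul_inv]
    ring
  -- stability under `diag(λ_j)`, from `λ_i^* M_ij - M_ij λ_j = v_i† v_j`
  have hker : ∀ u : Fin N → ℂ, matM lam v *ᵥ u = 0 →
      matM lam v *ᵥ (fun j => u j * lam j) = 0 := by
    intro u hu
    have hYu : matY v *ᵥ u = 0 := by
      rw [← hXM, ← Matrix.mulVec_mulVec, hu, Matrix.mulVec_zero]
    ext i
    have h1 := congrFun hu i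
    have h2 : ∑ j, (star (v i) ⬝ᵥ v j) * u j = 0 := by
      have h0 := congrFun hYu 0
      have h1 := congrFun hYu 1
      simp only [Matrix.mulVec, dotProduct, matY, Matrix.of_apply, Pi.zero_apply] at h0 h1
      simp only [dotProduct, Fin.sum_univ_two, add_mul, Finset.sum_add_distrib, mul_assoc,
        ← Finset.mul_sum, h0, h1, mul_zero, add_zero]
    simp only [Matrix.mulVec, dotProduct, Pi.zero_apply] at h1 ⊢
    have h3 : ∀ j, matM lam v i j * (u j * lam j)
        = conj (lam i) * (matM lam v i j * u j) - (star (v i) ⬝ᵥ v j) * u j := by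
      intro j
      have := sub_ne_zero.2 (hconj i j)
      simp only [matM, Matrix.of_apply]
      field_simp
      ring
    rw [Finset.sum_congr rfl fun j _ => h3 j, Finset.sum_sub_distrib, ← Finset.mul_sum, h1, h2]
    ring
  have hdet : IsUnit (matM lam v).det := by
    rw [isUnit_iff_ne_zero]
    intro h0
    obtain ⟨u, hu0, hu⟩ := Matrix.exists_mulVec_eq_zero_iff.2 h0
    have hpow : ∀ m : ℕ, matM lam v *ᵥ (fun j => u j * lam j ^ m) = 0 := by
      intro m
      induction m with
      | zero => simpa using hu
      | succ m ih => simpa only [pow_succ, mul_assoc] using hker _ ih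
    have hz : ∀ a, (fun j => v j a * u j) = 0 := fun a => by
      refine Matrix.eq_zero_of_forall_pow_sum_mul_pow_eq_zero hinj fun m => ?_
      have : matY v *ᵥ (fun j => u j * lam j ^ (m : ℕ)) = 0 := by
        rw [← hXM, ← Matrix.mulVec_mulVec, hpow, Matrix.mulVec_zero]
      have := congrFun this a
      simpa [Matrix.mulVec, dotProduct, matY, mul_assoc] using this
    refine hu0 (funext fun j => ?_)
    by_contra hj
    refine hv j (funext fun a => ?_)
    exact (mul_eq_zero.1 (congrFun (hz a) j)).resolve_right hj
  have hX : matY x = matY v * (matM lam v)⁻¹ := by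
    rw [← hXM, Matrix.mul_nonsing_inv_cancel_right _ _ hdet]
  refine ⟨hdet, fun z hz => ?_, fun q₀ => ?_⟩
  · rw [darbouxT, ← hX, hx z hz]
    have hD : (matD lam z)⁻¹ = Matrix.diagonal fun i => (z - conj (lam i))⁻¹ := by
      refine Matrix.inv_eq_right_inv ?_
      rw [matD, Matrix.diagonal_mul_diagonal, ← Matrix.diagonal_one]
      congr 1
      funext i
      exact mul_inv_cancel₀ (sub_ne_zero.2 (hz i))
    rw [hD]
    congr 1
    ext a b
    rw [Matrix.mul_apply, Matrix.sum_apply]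
    refine Finset.sum_congr rfl fun j _ => ?_
    simp only [Matrix.mul_diagonal, matY, Matrix.conjTranspose_apply, Matrix.of_apply,
      Matrix.smul_apply, Matrix.vecMulVec_apply, Pi.star_apply, smul_eq_mul]
    ring
  · rw [darbouxPot, hxp, Matrix.dotProduct_mulVec]
    have : matY v 1 ᵥ* (matM lam v)⁻¹ = matY x 1 := by rw [hX]; rfl
    rw [this]
    rfl

end PointwiseAlgebra

/-! ### Iteration of the Darboux transformation -/

section Iteration

/-- The `N`-fold Darboux transformation, by induction on the number of elementary steps. The
vectors are images `Ψ_i u_i` of constant vectors under matrix solutions of the Lax systems, so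
that each step transforms the remaining ones into vectors of the same kind. -/
theorem iterated_darboux {q : Space → ℂ} (hq : ContDiff ℝ ∞ q)
    (h2 : SecondFlow q (conjPot q)) (h3 : ThirdFlow q (conjPot q)) (N : ℕ) (lam : Fin N → ℂ)
    (hinj : Function.Injective lam) (hconj : ∀ i j, conj (lam i) ≠ lam j)
    (Ψ : Fin N → Space → Mat2) (hΨ : ∀ i, IsLaxSolution q (lam i) (Ψ i))
    (u : Fin N → Fin 2 → ℂ) (hu : ∀ i p, Ψ i p *ᵥ u i ≠ 0)
    {qN : Space → ℂ} (hqN : ∀ p, qN p = iterPot N lam (fun i => Ψ i p *ᵥ u i) (q p)) :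
    ContDiff ℝ ∞ qN ∧ SecondFlow qN (conjPot qN) ∧ ThirdFlow qN (conjPot qN) ∧
      ∀ z, (∀ i, z ≠ conj (lam i)) →
        IsDarboux q qN z fun p => iterT N lam (fun i => Ψ i p *ᵥ u i) z := by
  induction N generalizing qN with
  | zero =>
    obtain rfl : qN = q := funext hqN
    refine ⟨hq, h2, h3, fun z _ => ?_⟩
    have h0 : ∀ e p, entrywise (fun f p => fderiv ℝ f p e) (fun _ : Space => (1 : Mat2)) p = 0 := by
      intro e p
      ext i j
      simp [entrywise]
    refine ⟨fun i j => differentiable_const _, fun p => ?_, fun p => ?_, fun p => ?_⟩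
    · rw [show entrywise dx (fun p => iterT 0 lam (fun i => Ψ i p *ᵥ u i) z) p = 0 from h0 _ p]
      simp [iterT]
    · rw [show entrywise dy (fun p => iterT 0 lam (fun i => Ψ i p *ᵥ u i) z) p = 0 from h0 _ p]
      simp [iterT]
    · rw [show entrywise dt (fun p => iterT 0 lam (fun i => Ψ i p *ᵥ u i) z) p = 0 from h0 _ p]
      simp [iterT]
  | succ n ih =>
    obtain ⟨hq', h2', h3', hD⟩ := ih (fun i => lam i.castSucc)
      (hinj.comp (Fin.castSucc_injective n)) (fun i j => hconj _ _) (fun i => Ψ i.castSucc)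
      (fun i => hΨ _) (fun i => u i.castSucc) (fun i p => hu _ p) (qN := fun p =>
        iterPot n (fun i => lam i.castSucc) (fun i => Ψ i.castSucc p *ᵥ u i.castSucc) (q p))
      (fun p => rfl)
    have hw := ((hD (lam (Fin.last n)) fun i => (hconj _ _).symm).isLaxSolution
      (hΨ (Fin.last n))).isLaxVector hq' (u (Fin.last n))
    simp only [← Matrix.mulVec_mulVec] at hw
    obtain ⟨hq'', h2'', h3'', hD'⟩ := darboux_step hq' h2' h3' hw
      (fun p => iterT_mulVec_ne_zero lam hinj hconj (fun i => Ψ i p *ᵥ u i) fun i => hu i p)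
      (q' := qN) hqN
    exact ⟨hq'', h2'', h3'', fun z hz => (hD' z (hz _)).comp (hD z fun i => hz _)⟩

end Iteration

end AKNS

theorem mainTheorem3
    (q : AKNS.Space → ℂ) (hq_smooth : ContDiff ℝ ∞ q) (hq_bdd : ∃ C : ℝ, ∀ p, ‖q p‖ ≤ C)
    (hq_second : AKNS.SecondFlow q (AKNS.conjPot q))
    (hq_third : AKNS.ThirdFlow q (AKNS.conjPot q))
    (Φ : ℂ → AKNS.Space → AKNS.Mat2)
    (hΦ_lax : ∀ z, AKNS.IsLaxSolution q z (Φ z))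
    (hΦ_entire : ∀ p i j, Differentiable ℂ fun z => Φ z p i j)
    (N : ℕ) (lam : Fin N → ℂ)
    (hlam_inj : Function.Injective lam)
    (hlam_conj : ∀ i j, conj (lam i) ≠ lam j)
    (hΦ_inv : ∀ i, IsUnit (Φ (lam i) (0, 0, 0)).det)
    (c : Fin N → AKNS.Space → ℂ) (hc : ∀ i p, c i p ≠ 0)
    (φ : AKNS.Space → Fin N → Fin 2 → ℂ)
    (hφ : φ = fun p i => AKNS.phi Φ (lam i) (c i) p)
    (T : ℂ → AKNS.Space → AKNS.Mat2)
    (hT : T = fun z p => AKNS.darbouxT lam (φ p) z)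
    (qN : AKNS.Space → ℂ)
    (hqN : qN = fun p => AKNS.darbouxPot lam (φ p) (q p)) :
    -- the formulas are meaningful
    (∀ p, IsUnit (AKNS.matM lam (φ p)).det) ∧
    -- `T` and `qN` are the result of `N` successive elementary Darboux transformations
    (∀ z, (∀ i, z ≠ conj (lam i)) → ∀ p, T z p = AKNS.iterT N lam (φ p) z) ∧
    (∀ p, qN p = AKNS.iterPot N lam (φ p) (q p)) ∧
    -- `T` transforms the Lax pair of `q` into the Lax pair of `qN`
    (∀ z, (∀ i, z ≠ conj (lam i)) → AKNS.IsDarboux q qN z (T z)) ∧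
    (∀ z, (∀ i, z ≠ conj (lam i)) → (∀ i, z ≠ lam i) → ∀ p, IsUnit (T z p).det) ∧
    (∀ z, (∀ i, z ≠ conj (lam i)) → AKNS.IsLaxSolution qN z fun p => T z p * Φ z p) ∧
    -- the new potential solves both flows and gives a solution of the KP equation
    ContDiff ℝ ∞ qN ∧
    AKNS.SecondFlow qN (AKNS.conjPot qN) ∧
    AKNS.ThirdFlow qN (AKNS.conjPot qN) ∧
    AKNS.KP (fun p => qN p * AKNS.conjPot qN p) := by
  -- `det Φ` is constant, so `Φ (lam i)` is invertible everywhere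
  have hv : ∀ i p, (Φ (lam i) p * (Φ (lam i) (0, 0, 0))⁻¹) *ᵥ ![1, -Complex.I] ≠ 0 := by
    intro i p h
    have hu : IsUnit (Φ (lam i) p * (Φ (lam i) (0, 0, 0))⁻¹) := by
      rw [Matrix.isUnit_iff_isUnit_det, Matrix.det_mul, (hΦ_lax (lam i)).det_eq p (0, 0, 0)]
      exact (hΦ_inv i).mul (Matrix.isUnit_nonsing_inv_det _ (hΦ_inv i))
    have h0 := congrFun (Matrix.mulVec_injective_of_isUnit hu
      (h.trans (Matrix.mulVec_zero _).symm)) 0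
    simp at h0
  -- the scalar factors `c i` drop out, so that arbitrary functions are admissible
  have hφ0 : ∀ p i, φ p i ≠ 0 := fun p i => by
    rw [hφ]; exact smul_ne_zero (hc i p) (hv i p)
  have hφT : ∀ z p, AKNS.iterT N lam (φ p) z = AKNS.iterT N lam (fun i =>
      Φ (lam i) p *ᵥ ((Φ (lam i) (0, 0, 0))⁻¹ *ᵥ ![1, -Complex.I])) z := fun z p => by
    simp only [Matrix.mulVec_mulVec]
    rw [hφ]
    exact AKNS.iterT_smul N lam _ (fun i => c i p) (fun i => hc i p) z
  have hφq : ∀ p, AKNS.iterPot N lam (φ p) (q p) = AKNS.iterPot N lam (fun i =>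
      Φ (lam i) p *ᵥ ((Φ (lam i) (0, 0, 0))⁻¹ *ᵥ ![1, -Complex.I])) (q p) := fun p => by
    simp only [Matrix.mulVec_mulVec]
    rw [hφ]
    exact AKNS.iterPot_smul N lam _ (fun i => c i p) (fun i => hc i p) (q p)
  have hclosed := fun p => AKNS.closed_form N lam hlam_inj hlam_conj (φ p) (hφ0 p)
  have hTz : ∀ z, (∀ i, z ≠ conj (lam i)) → ∀ p, T z p = AKNS.iterT N lam (φ p) z :=
    fun z hz p => by rw [hT]; exact (hclosed p).2.1 z hz
  have hqp : ∀ p, qN p = AKNS.iterPot N lam (φ p) (q p) :=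
    fun p => by rw [hqN]; exact (hclosed p).2.2 (q p)
  obtain ⟨hs, h2, h3, hD⟩ := AKNS.iterated_darboux hq_smooth hq_second hq_third N lam hlam_inj
    hlam_conj (fun i => Φ (lam i)) (fun i => hΦ_lax (lam i))
    (fun i => (Φ (lam i) (0, 0, 0))⁻¹ *ᵥ ![1, -Complex.I])
    (fun i p => by rw [Matrix.mulVec_mulVec]; exact hv i p)
    (qN := qN) (fun p => (hqp p).trans (hφq p))
  have hDT : ∀ z, (∀ i, z ≠ conj (lam i)) → AKNS.IsDarboux q qN z (T z) := fun z hz => by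
    rw [show T z = _ from funext fun p => (hTz z hz p).trans (hφT z p)]
    exact hD z hz
  exact ⟨fun p => (hclosed p).1, hTz, hqp, hDT,
    fun z h1 h2 p => by rw [hTz z h1]; exact AKNS.isUnit_det_iterT N lam _ h1 h2,
    fun z hz => (hDT z hz).isLaxSolution (hΦ_lax z), hs, h2, h3,
    AKNS.kp_of_secondFlow_of_thirdFlow hs h2 h3⟩
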